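/- Let $\mathbb R^+=(0,\infty)$, let $n\ge 1$ and $1\le p<2$, and define $q,s_n\in(0,\infty]$ by $q^{-1}+p^{-1}=1$ and $s_n^{-1}=nq^{-1}$ (so $q=s_n=\infty$ if $p=1$; possibly $s_n<1$). Let $B_0,B_2\ge 0$. There is a constant $C_n<\infty$, depending only on $n,p,B_0,B_2$, such that the following holds. Let $I\subset\mathbb R$ be Lebesgue measurable and let $k_1,\dots,k_n$ be measurable complex-valued functions on $I\times\mathbb R^+$ such that for each $i$: $|k_i(\lambda,x)|\le B_0$ for all $(\lambda,x)\in I\times\mathbb R^+$, and the operator $(K_if)(\lambda)=\int_{\mathbb R^+}k_i(\lambda,x)f(x)\,dx$ satisfies $\|K_if\|_{L^2(I)}\le B_2\|f\|_{L^2(\mathbb R^+)}$ for all bounded measurable $f$ of compact support. Let $A$ be any set of ordered pairs $\alpha=(i_\alpha,i'_\alpha)$ with $1\le i_\alpha,i'_\alpha\le n$. For $D_1,\dots,D_n\in\mathbb R^+\cup\{\infty\}$ put $$T_n^{D_1,\dots,D_n}(f_1,\dots,f_n)(\lambda)=\int_{(\mathbb R^+)^n}\prod_{j=1}^n k_j(\lambda,x_j)\,\chi_{\{x_j<D_j\}}\,f_j(x_j)\prod_{\alpha\in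 A}\chi_{\mathbb R^+}(x_{i_\alpha}-x_{i'_\alpha})\,dx .$$ Let $f_1,\dots,f_n\in L^p(\mathbb R^+)$ be complex-valued. Then for almost every $\lambda\in I$ this integral converges absolutely for all finite $D_1,\dots,D_n$. Put $$M_T(f_1,\dots,f_n)(\lambda)=\sup_{D_1,\dots,D_n}\left|T_n^{D_1,\dots,D_n}(f_1,\dots,f_n)(\lambda)\right|\in[0,\infty],$$ the supremum being over all $D_1,\dots,D_n\in\mathbb R^+\cup\{\infty\}$ for which the integral converges absolutely. Then $M_T(f_1,\dots,f_n)$ is (Lebesgue) measurable on $I$ up to modification on a null set, and $$\|M_T(f_1,\dots,f_n)\|_{L^{s_n}(I)}\le C_n\prod_{i=1}^n\|f_i\|_{L^p(\mathbb R^+)} ,$$ where $\|g\|_{L^s(I)}=\left(\int_I|g|^s\,d\lambda\right)^{1/s}$ for $0<s<\infty$, and $\|g\|_{L^\infty(I)}$ is the essential supremum. -/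

import Mathlib

open MeasureTheory Set
open scoped ENNReal NNReal

/-- The integral operator `(K f)(lam) = ∫_{R⁺} k(lam, x) f(x) dx`, where `R⁺ = (0, ∞)`. -/
noncomputable def kernelOp (k : ℝ → ℝ → ℂ) (f : ℝ → ℂ) (lam : ℝ) : ℂ :=
  ∫ x in Ioi (0 : ℝ), k lam x * f x

/-- `‖K f‖_{L²(I)} ≤ B ‖f‖_{L²(R⁺)}` for all bounded measurable `f` of compact support. -/
def L2Bound (I : Set ℝ) (k : ℝ → ℝ → ℂ) (B : ℝ≥0) : Prop :=
  ∀ f : ℝ → ℂ, Measurable f → (∃ M : ℝ, ∀ x, ‖f x‖ ≤ M) → HasCompactSupport f →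
    eLpNorm (kernelOp k f) 2 (volume.restrict I)
      ≤ (B : ℝ≥0∞) * eLpNorm f 2 (volume.restrict (Ioi (0 : ℝ)))

/-- The positive orthant `(R⁺)ⁿ`. -/
def posOrthant (n : ℕ) : Set (Fin n → ℝ) := {x | ∀ j, 0 < x j}

/-- The integrand
`∏_j k_j(lam, x_j) f_j(x_j) · ∏_{α ∈ A} χ_{R⁺}(x_{i_α} - x_{i'_α})`. -/
noncomputable def multilinearIntegrand {n : ℕ} (k : Fin n → ℝ → ℝ → ℂ)
    (A : Finset (Fin n × Fin n)) (f : Fin n → ℝ → ℂ) (lam : ℝ) (x : Fin n → ℝ) : ℂ :=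
  (∏ j, k j lam (x j) * f j (x j)) *
    ∏ α ∈ A, (Ioi (0 : ℝ)).indicator (fun _ => (1 : ℂ)) (x α.1 - x α.2)

/-- The multilinear operator `T_n(f_1, …, f_n)(lam)`. -/
noncomputable def multilinearOp {n : ℕ} (k : Fin n → ℝ → ℝ → ℂ)
    (A : Finset (Fin n × Fin n)) (f : Fin n → ℝ → ℂ) (lam : ℝ) : ℂ :=
  ∫ x in posOrthant n, multilinearIntegrand k A f lam x

/-- The truncated kernels `k_i(lam, x) χ_{R⁺}(D_i - x)` (used for `x > 0`), `D_i ∈ [0, ∞]`. -/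
noncomputable def truncKernel {n : ℕ} (k : Fin n → ℝ → ℝ → ℂ) (D : Fin n → ℝ≥0∞) :
    Fin n → ℝ → ℝ → ℂ :=
  fun i lam => {x : ℝ | ENNReal.ofReal x < D i}.indicator (k i lam)

/-- The maximal function `M_T(f_1, …, f_n)(lam) = sup_D |T_n^{D_1, …, D_n}(f_1, …, f_n)(lam)|`, the
supremum over all `D_1, …, D_n ∈ R⁺ ∪ {∞}`. If some `D_i` are infinite, then the integral need not
converge absolutely; such a `D` contributes `0`, that is, it does not affect the supremum. -/
noncomputable def maximalOp {n : ℕ} (k : Fin n → ℝ → ℝ → ℂ)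
    (A : Finset (Fin n × Fin n)) (f : Fin n → ℝ → ℂ) (lam : ℝ) : ℝ≥0∞ :=
  ⨆ (D : Fin n → ℝ≥0∞) (_ : ∀ i, 0 < D i), ‖multilinearOp (truncKernel k D) A f lam‖ₑ

/-!
The proof follows the Christ–Kiselev method: the maximal operator is dominated pointwise by a power
of one explicit function built from dyadic increments, and that function is controlled in `L¹`.

Let `1 < p < 2`, let `‖f i‖_p ≤ 1`, and restrict to `(0, R]`. Quantiles common to all `|f i|^p`
(`exists_quantile`) give a dyadic tree of intervals `J` on which, in generation `m`, each `|f i|^p`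
has mass at most `(n + 1) / 2 ^ m`. Marcinkiewicz interpolation (`lintegral_kernelOp_rpow_le`) bounds
the `L^q` norms of the increments `K_i (f i χ_J)`. Since `p < 2`, there is room for a weight
`2 ^ (δ m)` with `q / 2 - 1 < δ < q - 2`: the weighted sum `dyadicSum` of the `q`-th powers of all
increments still has bounded integral (`exists_lintegral_dyadicSum_le`), while pointwise, by the
weight and the uniform splitting, the increments have a majorant `b` whose *squares* decay
geometrically along the tree (`exists_dyadic_majorant`).

The rest of the main estimate is deterministic. An integral over `J` splits over the halves
`J = J_l ∪ J_r`: the variables in `J_l` and those in `J_r` decouple, because order relations between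
the two groups are either automatic or impossible (`norm_integral_orderedProd_union_le`). For one
variable a truncation only selects a branch of the tree (`branch_bound`); for two or more variables
the geometric decay of the squares makes the recursion summable (`tree_bound`). Hence every
truncated integral is at most `C * b ^ n`, that is, `C * dyadicSum ^ (n / q)`, uniformly in the
truncation and in `R`, and the power `s = q / n` of the maximal function is integrable.

Dominated convergence reduces the supremum to countably many finite truncations
(`maximalOp_eq_iSup_boundedMaximalOp`), which gives measurability, and monotone convergence then
removes the restriction to `(0, R]`. The endpoint `p = 1` is immediate from Fubini's theorem
(`norm_multilinearOp_le`).
-/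

/-! ### Multilinear bounds on the dyadic tree -/

theorem child_le_of_sq_add_sq_le {θ : ℝ} (hθ0 : 0 ≤ θ) {x y z : ℝ} (hz : 0 ≤ z)
    (h : x ^ 2 + y ^ 2 ≤ θ ^ 2 * z ^ 2) : x ≤ θ * z ∧ y ≤ θ * z := by
  have hθz : 0 ≤ θ * z := mul_nonneg hθ0 hz
  constructor <;> refine le_of_sq_le_sq ?_ hθz
  · nlinarith [sq_nonneg y]
  · nlinarith [sq_nonneg x]

theorem le_of_forall_le_add_geometric {x c E ρ : ℝ} (hρ0 : 0 ≤ ρ) (hρ1 : ρ < 1)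
    (h : ∀ d : ℕ, x ≤ c + E * ρ ^ d) : x ≤ c := by
  have : Filter.Tendsto (fun d : ℕ => c + E * ρ ^ d) Filter.atTop (nhds (c + E * 0)) :=
    ((tendsto_pow_atTop_nhds_zero_of_lt_one hρ0 hρ1).const_mul E).const_add c
  simpa using ge_of_tendsto' this h

/-- At each step at most one increment of the dyadic tree is added and one passes to a child, so
geometric decay of `b` along branches bounds a truncated increment by `b`. -/
theorem branch_bound {θ : ℝ} (hθ0 : 0 ≤ θ) (hθ1 : θ < 1) {b : ℕ → ℕ → ℝ} (hb : ∀ m j, 0 ≤ b m j)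
    (hb2 : ∀ m j, b (m + 1) (2 * j) ^ 2 + b (m + 1) (2 * j + 1) ^ 2 ≤ θ ^ 2 * b m j ^ 2)
    {t : ℕ → ℕ → ℝ} {E ρ : ℝ} (hρ0 : 0 ≤ ρ) (hρ1 : ρ < 1) (ht : ∀ m j, t m j ≤ E * ρ ^ m)
    (hrec : ∀ m j, t m j ≤ t (m + 1) (2 * j) ∨
      t m j ≤ b (m + 1) (2 * j) + t (m + 1) (2 * j + 1)) (m j : ℕ) :
    t m j ≤ (1 - θ)⁻¹ * b m j := by
  have key : ∀ d m j, t m j ≤ (1 - θ)⁻¹ * b m j + E * ρ ^ (m + d) := by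
    intro d
    induction d with
    | zero =>
      intro m j
      have : 0 ≤ (1 - θ)⁻¹ * b m j := mul_nonneg (inv_nonneg.2 (by linarith)) (hb m j)
      simpa using (ht m j).trans (by linarith)
    | succ d ih =>
      intro m j
      obtain ⟨hl, hr⟩ := child_le_of_sq_add_sq_le hθ0 (hb m j) (hb2 m j)
      have hpos : 0 < 1 - θ := by linarith
      have hC : θ + (1 - θ)⁻¹ * θ ≤ (1 - θ)⁻¹ := by
        have h1 : (1 - θ)⁻¹ - (1 - θ)⁻¹ * θ = 1 := by field_simp
        linarith
      have e : m + (d + 1) = m + 1 + d := by ring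
      rw [e]
      have hi : 0 ≤ (1 - θ)⁻¹ := inv_nonneg.2 hpos.le
      have hCb := mul_le_mul_of_nonneg_right hC (hb m j)
      have hθb : 0 ≤ θ * b m j := mul_nonneg hθ0 (hb m j)
      rcases hrec m j with h | h
      · have := ih (m + 1) (2 * j)
        have := mul_le_mul_of_nonneg_left hl hi
        nlinarith
      · have := ih (m + 1) (2 * j + 1)
        have := mul_le_mul_of_nonneg_left hr hi
        nlinarith
  refine le_of_forall_le_add_geometric (E := E * ρ ^ m) hρ0 hρ1 fun d => ?_
  simpa [pow_add, mul_assoc] using key d m j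

/-- A multilinear quantity `T S m j`, indexed by sets `S` of variables and nodes `(m, j)` of the
dyadic tree, that splits over the two children of a node is bounded by `b m j ^ #S`, as soon as this
holds for single variables. Squares of `b` decay geometrically when summed over the levels below a
node, so for `2 ≤ #S` the contributions of the splittings form a convergent series; the smallness
hypothesis `hsmall` serves only to discard the remainder. -/
theorem tree_bound {ι : Type*} [DecidableEq ι] {θ c : ℝ} (hθ1 : θ ^ 2 < 1) (hθ0 : 0 ≤ θ)
    (hc : 0 ≤ c) (N : ℕ) : ∃ C : ℝ, 0 ≤ C ∧ ∀ (b : ℕ → ℕ → ℝ), (∀ m j, 0 ≤ b m j) →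
    (∀ m j, b (m + 1) (2 * j) ^ 2 + b (m + 1) (2 * j + 1) ^ 2 ≤ θ ^ 2 * b m j ^ 2) →
    ∀ (T : Finset ι → ℕ → ℕ → ℝ), (∀ S m j, 0 ≤ T S m j) → (∀ m j, T ∅ m j ≤ 1) →
    (∀ S m j, T S m j ≤ ∑ L ∈ S.powerset, T L (m + 1) (2 * j) * T (S \ L) (m + 1) (2 * j + 1)) →
    (∀ i m j, T {i} m j ≤ c * b m j) →
    ∀ (ρ : ℝ), 0 ≤ ρ → 2 * ρ < 1 →
    (∀ S : Finset ι, 2 ≤ S.card → ∃ E : ℝ, ∀ m j, T S m j ≤ E * ρ ^ m) →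
    ∀ S : Finset ι, 1 ≤ S.card → S.card ≤ N → ∀ m j, T S m j ≤ C * b m j ^ S.card := by
  induction N with
  | zero => exact ⟨0, le_rfl, fun b _ _ T _ _ _ _ ρ _ _ _ S h1 h2 => by omega⟩
  | succ N ih =>
    obtain ⟨C, hC0, hC⟩ := ih
    have hpos : 0 < 1 - θ ^ 2 := by linarith
    set C' : ℝ := 2 ^ (N + 1) * C ^ 2 * (1 - θ ^ 2)⁻¹ with hC'
    have hC'0 : 0 ≤ C' := by positivity
    refine ⟨c + C', by positivity, ?_⟩
    intro b hb hb2 T hT0 hTe hrec hsing ρ hρ0 hρ1 hsmall S hS1 hSN m j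
    rcases Nat.lt_or_ge S.card 2 with h2 | h2
    · obtain ⟨i, rfl⟩ := Finset.card_eq_one.1 (show S.card = 1 by omega)
      have := hsing i m j
      have := mul_nonneg hC'0 (hb m j)
      simp only [Finset.card_singleton, pow_one]
      linarith
    have hlow := hC b hb hb2 T hT0 hTe hrec hsing ρ hρ0 hρ1 hsmall
    have hchild : ∀ m j, b (m + 1) (2 * j) ≤ b m j ∧ b (m + 1) (2 * j + 1) ≤ b m j := by
      intro m j
      obtain ⟨hl, hr⟩ := child_le_of_sq_add_sq_le (by positivity) (hb m j) (hb2 m j)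
      have hθ : θ ≤ 1 := by nlinarith
      have := mul_le_mul_of_nonneg_right hθ (hb m j)
      constructor <;> linarith
    have hpow : ∀ m j, b (m + 1) (2 * j) ^ S.card + b (m + 1) (2 * j + 1) ^ S.card
        ≤ θ ^ 2 * b m j ^ S.card := by
      intro m j
      obtain ⟨k, hk⟩ := Nat.exists_eq_add_of_le h2
      rw [hk, pow_add, pow_add, pow_add]
      have h1 := pow_le_pow_left₀ (hb _ _) (hchild m j).1 k
      have h2 := pow_le_pow_left₀ (hb _ _) (hchild m j).2 k
      have h3 := mul_le_mul_of_nonneg_right (hb2 m j) (pow_nonneg (hb m j) k)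
      have h4 := mul_le_mul_of_nonneg_left h1 (sq_nonneg (b (m + 1) (2 * j)))
      have h5 := mul_le_mul_of_nonneg_left h2 (sq_nonneg (b (m + 1) (2 * j + 1)))
      linarith
    have hsplit : ∀ m j, T S m j ≤ T S (m + 1) (2 * j) + T S (m + 1) (2 * j + 1)
        + 2 ^ (N + 1) * C ^ 2 * b m j ^ S.card := by
      intro m j
      have hterm : ∀ L ∈ S.powerset, T L (m + 1) (2 * j) * T (S \ L) (m + 1) (2 * j + 1) ≤
          (if L = S then T S (m + 1) (2 * j) else 0)
          + (if L = ∅ then T S (m + 1) (2 * j + 1) else 0) + C ^ 2 * b m j ^ S.card := by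
        intro L hL
        have hLS := Finset.mem_powerset.1 hL
        have hC2 : 0 ≤ C ^ 2 * b m j ^ S.card := mul_nonneg (sq_nonneg _) (pow_nonneg (hb _ _) _)
        have hSne : S ≠ ∅ := by rintro rfl; simp at h2
        by_cases h1 : L = S
        · subst h1
          have := mul_le_mul_of_nonneg_left (hTe (m + 1) (2 * j + 1)) (hT0 L (m + 1) (2 * j))
          simp only [Finset.sdiff_self, if_true, hSne, if_false]
          linarith
        by_cases h2 : L = ∅
        · subst h2
          have := mul_le_mul_of_nonneg_right (hTe (m + 1) (2 * j)) (hT0 S (m + 1) (2 * j + 1))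
          simp only [Finset.sdiff_empty, if_true, h1, if_false]
          linarith
        simp only [h1, h2, if_false, zero_add]
        have hc1 : 1 ≤ L.card := Finset.card_pos.2 (Finset.nonempty_of_ne_empty h2)
        have hcS : L.card < S.card :=
          Finset.card_lt_card (Finset.ssubset_iff_subset_ne.2 ⟨hLS, h1⟩)
        have hcd : (S \ L).card = S.card - L.card := Finset.card_sdiff_of_subset hLS
        have e1 := hlow L hc1 (by omega) (m + 1) (2 * j)
        have e2 := hlow (S \ L) (by omega) (by omega) (m + 1) (2 * j + 1)
        calc _ ≤ (C * b (m + 1) (2 * j) ^ L.card) * (C * b (m + 1) (2 * j + 1) ^ (S \ L).card) :=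
              mul_le_mul e1 e2 (hT0 _ _ _) (mul_nonneg hC0 (pow_nonneg (hb _ _) _))
          _ ≤ (C * b m j ^ L.card) * (C * b m j ^ (S \ L).card) := by
              have h3 := pow_le_pow_left₀ (hb _ _) (hchild m j).1 L.card
              have h4 := pow_le_pow_left₀ (hb _ _) (hchild m j).2 (S \ L).card
              have h5 := pow_nonneg (hb (m + 1) (2 * j + 1)) (S \ L).card
              have h6 := pow_nonneg (hb m j) L.card
              gcongr
          _ = C ^ 2 * (b m j ^ L.card * b m j ^ (S \ L).card) := by ring
          _ = C ^ 2 * b m j ^ S.card := by rw [← pow_add]; congr 2; omega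
      refine (hrec S m j).trans ((Finset.sum_le_sum hterm).trans ?_)
      rw [Finset.sum_add_distrib, Finset.sum_add_distrib, Finset.sum_ite_eq', Finset.sum_ite_eq']
      simp only [Finset.mem_powerset, subset_refl, Finset.empty_subset, if_true, Finset.sum_const,
        Finset.card_powerset, nsmul_eq_mul]
      have : ((2 ^ S.card : ℕ) : ℝ) ≤ 2 ^ (N + 1) := by
        push_cast; exact pow_le_pow_right₀ (by norm_num) hSN
      have hC2 : 0 ≤ C ^ 2 * b m j ^ S.card := mul_nonneg (sq_nonneg _) (pow_nonneg (hb _ _) _)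
      have := mul_le_mul_of_nonneg_right this hC2
      linarith
    obtain ⟨E, hE⟩ := hsmall S h2
    have key : ∀ d m j, T S m j ≤ C' * b m j ^ S.card + E * ρ ^ m * (2 * ρ) ^ d := by
      intro d
      induction d with
      | zero =>
        intro m j
        have := mul_nonneg hC'0 (pow_nonneg (hb m j) S.card)
        have := hE m j
        simp only [pow_zero, mul_one]
        linarith
      | succ d ih =>
        intro m j
        have e1 := ih (m + 1) (2 * j)
        have e2 := ih (m + 1) (2 * j + 1)
        have e3 := hsplit m j
        have e4 := mul_le_mul_of_nonneg_left (hpow m j) hC'0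
        have e5 : 2 ^ (N + 1) * C ^ 2 = C' * (1 - θ ^ 2) := by rw [hC']; field_simp
        rw [e5] at e3
        have e6 : E * ρ ^ m * (2 * ρ) ^ (d + 1) = 2 * (E * ρ ^ (m + 1) * (2 * ρ) ^ d) := by ring
        rw [e6]
        linarith
    have h := le_of_forall_le_add_geometric (by positivity) hρ1 fun d => key d m j
    have := mul_nonneg hc (pow_nonneg (hb m j) S.card)
    linarith

/-! ### Ordered products and their splitting -/

open Classical in
/-- The integrand of the multilinear operator in which only the variables with index in `S` are
active, each of them confined to `J`, and only the order relations among active variables count. -/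
noncomputable def orderedProd {ι : Type*} (A : Finset (ι × ι)) (g : ι → ℝ → ℂ)
    (S : Finset ι) (J : Set ℝ) (x : ι → ℝ) : ℂ :=
  if ∀ α ∈ A, α.1 ∈ S → α.2 ∈ S → x α.2 < x α.1 then ∏ i ∈ S, J.indicator (g i) (x i) else 0

section OrderedProd
variable {ι : Type*} {A : Finset (ι × ι)} {g : ι → ℝ → ℂ}

theorem orderedProd_congr {S : Finset ι} {J : Set ℝ} {x y : ι → ℝ} (h : ∀ i ∈ S, x i = y i) :
    orderedProd A g S J x = orderedProd A g S J y := by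
  classical
  unfold orderedProd
  have h1 : (∏ i ∈ S, J.indicator (g i) (x i)) = ∏ i ∈ S, J.indicator (g i) (y i) :=
    Finset.prod_congr rfl fun i hi => by rw [h i hi]
  have h2 : (∀ α ∈ A, α.1 ∈ S → α.2 ∈ S → x α.2 < x α.1) ↔
      (∀ α ∈ A, α.1 ∈ S → α.2 ∈ S → y α.2 < y α.1) := by
    refine forall₄_congr fun α _ h1 h2 => ?_
    rw [h _ h1, h _ h2]
  simp only [h1, h2]

theorem norm_orderedProd_le (S : Finset ι) (J : Set ℝ) (x : ι → ℝ) :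
    ‖orderedProd A g S J x‖ ≤ ∏ i ∈ S, ‖J.indicator (g i) (x i)‖ := by
  unfold orderedProd
  split_ifs
  · rw [norm_prod]
  · rw [norm_zero]; exact Finset.prod_nonneg fun _ _ => norm_nonneg _

theorem measurable_orderedProd (hg : ∀ i, Measurable (g i)) (S : Finset ι) {J : Set ℝ}
    (hJ : MeasurableSet J) : Measurable (orderedProd A g S J) := by
  unfold orderedProd
  refine Measurable.ite ?_ ?_ measurable_const
  · simp only [ofPred_forall]
    refine Finset.measurableSet_biInter _ fun α _ => MeasurableSet.iInter fun _ =>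
      MeasurableSet.iInter fun _ => measurableSet_lt (measurable_pi_apply _) (measurable_pi_apply _)
  · exact Finset.measurable_prod _ fun i _ =>
      ((hg i).indicator hJ).comp (measurable_pi_apply i)

/-- Expanding the product over the two halves of the interval: a relation between the two groups of
variables is either impossible, which kills the term, or automatic. -/
theorem orderedProd_union [DecidableEq ι] {S : Finset ι} {J J' : Set ℝ}
    (hJ : ∀ y ∈ J, ∀ z ∈ J', y < z) (x : ι → ℝ) :
    orderedProd A g S (J ∪ J') x = ∑ L ∈ S.powerset,
      (if ∃ α ∈ A, α.1 ∈ L ∧ α.2 ∈ S \ L then (0 : ℂ) else 1) *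
        (orderedProd A g L J x * orderedProd A g (S \ L) J' x) := by
  classical
  have hdisj : Disjoint J J' := Set.disjoint_left.2 fun y h1 h2 => lt_irrefl _ (hJ y h1 y h2)
  have h1 : (∏ i ∈ S, (J ∪ J').indicator (g i) (x i)) = ∑ L ∈ S.powerset,
      (∏ i ∈ L, J.indicator (g i) (x i)) * ∏ i ∈ S \ L, J'.indicator (g i) (x i) := by
    rw [← Finset.prod_add]
    refine Finset.prod_congr rfl fun i _ => ?_
    rw [Set.indicator_union_of_disjoint hdisj]
  have h2 : orderedProd A g S (J ∪ J') x = ∑ L ∈ S.powerset,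
      if ∀ α ∈ A, α.1 ∈ S → α.2 ∈ S → x α.2 < x α.1 then
      (∏ i ∈ L, J.indicator (g i) (x i)) * ∏ i ∈ S \ L, J'.indicator (g i) (x i) else 0 := by
    unfold orderedProd
    split_ifs
    · exact h1
    · simp
  rw [h2]
  refine Finset.sum_congr rfl fun L hL => ?_
  have hLS := Finset.mem_powerset.1 hL
  by_cases hx : (∀ i ∈ L, x i ∈ J) ∧ ∀ i ∈ S \ L, x i ∈ J'
  · obtain ⟨hx1, hx2⟩ := hx
    by_cases hbad : ∃ α ∈ A, α.1 ∈ L ∧ α.2 ∈ S \ L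
    · obtain ⟨α, hα, ha1, ha2⟩ := hbad
      have hnot : ¬ ∀ α ∈ A, α.1 ∈ S → α.2 ∈ S → x α.2 < x α.1 := fun h =>
        lt_asymm (hJ _ (hx1 _ ha1) _ (hx2 _ ha2)) (h α hα (hLS ha1) (Finset.mem_sdiff.1 ha2).1)
      have hbad : ∃ α ∈ A, α.1 ∈ L ∧ α.2 ∈ S \ L := ⟨α, hα, ha1, ha2⟩
      rw [if_pos hbad, if_neg hnot, zero_mul]
    · rw [if_neg hbad, one_mul]
      have hiff : (∀ α ∈ A, α.1 ∈ S → α.2 ∈ S → x α.2 < x α.1) ↔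
          (∀ α ∈ A, α.1 ∈ L → α.2 ∈ L → x α.2 < x α.1) ∧
          (∀ α ∈ A, α.1 ∈ S \ L → α.2 ∈ S \ L → x α.2 < x α.1) := by
        constructor
        · intro h
          exact ⟨fun α hα a1 a2 => h α hα (hLS a1) (hLS a2), fun α hα a1 a2 =>
            h α hα (Finset.mem_sdiff.1 a1).1 (Finset.mem_sdiff.1 a2).1⟩
        · rintro ⟨h1, h2⟩ α hα a1 a2
          by_cases b1 : α.1 ∈ L <;> by_cases b2 : α.2 ∈ L
          · exact h1 α hα b1 b2
          · exact absurd ⟨α, hα, b1, Finset.mem_sdiff.2 ⟨a2, b2⟩⟩ hbad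
          · exact hJ _ (hx1 _ b2) _ (hx2 _ (Finset.mem_sdiff.2 ⟨a1, b1⟩))
          · exact h2 α hα (Finset.mem_sdiff.2 ⟨a1, b1⟩) (Finset.mem_sdiff.2 ⟨a2, b2⟩)
      unfold orderedProd
      simp only [hiff]
      split_ifs <;> simp_all
  · have hz : (∏ i ∈ L, J.indicator (g i) (x i)) * ∏ i ∈ S \ L, J'.indicator (g i) (x i) = 0 := by
      rw [not_and_or] at hx
      push Not at hx
      rcases hx with ⟨i, hi, h⟩ | ⟨i, hi, h⟩
      · rw [Finset.prod_eq_zero hi (Set.indicator_of_notMem h _), zero_mul]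
      · rw [Finset.prod_eq_zero hi (Set.indicator_of_notMem h _), mul_zero]
    have hz2 : orderedProd A g L J x * orderedProd A g (S \ L) J' x = 0 := by
      unfold orderedProd
      split_ifs <;> simp [hz]
    rw [hz, hz2, ite_self, mul_zero]

variable [Fintype ι] {P : Measure ℝ} [IsProbabilityMeasure P]

theorem integrable_orderedProd (hg : ∀ i, Measurable (g i)) (hgi : ∀ i, Integrable (g i) P)
    (S : Finset ι) {J : Set ℝ} (hJ : MeasurableSet J) :
    Integrable (orderedProd A g S J) (Measure.pi fun _ : ι => P) := by
  classical
  have h : Integrable (fun x : ι → ℝ => ∏ i, (if i ∈ S then J.indicator (g i) else 1) (x i))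
      (Measure.pi fun _ : ι => P) := by
    refine Integrable.fintype_prod (f := fun i => if i ∈ S then J.indicator (g i) else 1)
      fun i => ?_
    split_ifs
    · exact (hgi i).indicator hJ
    · exact integrable_const (1 : ℂ)
  refine h.mono (measurable_orderedProd hg S hJ).aestronglyMeasurable (ae_of_all _ fun x => ?_)
  refine (norm_orderedProd_le S J x).trans (le_of_eq ?_)
  rw [norm_prod, ← Finset.prod_subset (Finset.subset_univ S)]
  · exact Finset.prod_congr rfl fun i hi => by rw [if_pos hi]
  · intro i _ hi
    rw [if_neg hi]; simp

theorem norm_integral_orderedProd_le_prod (hg : ∀ i, Measurable (g i))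
    (hgi : ∀ i, Integrable (g i) P) (S : Finset ι) {J : Set ℝ} (hJ : MeasurableSet J) :
    ‖∫ x, orderedProd A g S J x ∂(Measure.pi fun _ : ι => P)‖ ≤
      ∏ i ∈ S, ∫ y in J, ‖g i y‖ ∂P := by
  classical
  have h : Integrable (fun x : ι → ℝ => ∏ i, (if i ∈ S then fun y => ‖J.indicator (g i) y‖
      else 1 : ℝ → ℝ) (x i)) (Measure.pi fun _ : ι => P) := by
    refine Integrable.fintype_prod (f := fun i => if i ∈ S then fun y => ‖J.indicator (g i) y‖
      else 1) fun i => ?_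
    split_ifs
    · exact ((hgi i).indicator hJ).norm
    · exact integrable_const (1 : ℝ)
  refine (norm_integral_le_integral_norm _).trans ?_
  calc _ ≤ ∫ x : ι → ℝ, ∏ i, (if i ∈ S then fun y => ‖J.indicator (g i) y‖
      else 1 : ℝ → ℝ) (x i) ∂(Measure.pi fun _ : ι => P) := by
        refine integral_mono (integrable_orderedProd hg hgi S hJ).norm h fun x => ?_
        refine (norm_orderedProd_le S J x).trans (le_of_eq ?_)
        rw [← Finset.prod_subset (Finset.subset_univ S)]
        · exact Finset.prod_congr rfl fun i hi => by rw [if_pos hi]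
        · intro i _ hi
          rw [if_neg hi]; simp
    _ = ∏ i ∈ S, ∫ y in J, ‖g i y‖ ∂P := by
        rw [integral_fintype_prod_eq_prod (fun i => (if i ∈ S then fun y => ‖J.indicator (g i) y‖
          else 1 : ℝ → ℝ)), ← Finset.prod_subset (Finset.subset_univ S)]
        · refine Finset.prod_congr rfl fun i hi => ?_
          rw [if_pos hi, ← integral_indicator hJ]
          simp only [norm_indicator_eq_indicator_norm]
        · intro i _ hi
          rw [if_neg hi]; simp

theorem norm_integral_orderedProd_singleton_le (hg : ∀ i, Measurable (g i)) (i : ι) {J : Set ℝ}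
    (hJ : MeasurableSet J) :
    ‖∫ x, orderedProd A g {i} J x ∂(Measure.pi fun _ : ι => P)‖ ≤ ‖∫ y in J, g i y ∂P‖ := by
  classical
  by_cases h : (i, i) ∈ A
  · have : ∀ x, orderedProd A g {i} J x = 0 := by
      intro x
      unfold orderedProd
      rw [if_neg]
      intro h1
      exact lt_irrefl _ (h1 (i, i) h (by simp) (by simp))
    simp [this]
  · have h1 : ∀ x, orderedProd A g {i} J x = J.indicator (g i) (x i) := by
      intro x
      unfold orderedProd
      rw [if_pos]
      · simp
      · rintro ⟨a, c⟩ hα h1 h2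
        simp only [Finset.mem_singleton] at h1 h2
        subst h1; subst h2
        exact absurd hα h
    simp only [h1]
    have e := (measurePreserving_eval (fun _ : ι => P) i)
    have e2 := integral_map (φ := Function.eval i) (μ := Measure.pi fun _ : ι => P)
      (f := J.indicator (g i)) (measurable_pi_apply i).aemeasurable
      ((hg i).indicator hJ).aestronglyMeasurable
    rw [e.map_eq, integral_indicator hJ] at e2
    rw [e2]

/-- Functions of disjoint groups of coordinates are independent. -/
theorem indepFun_orderedProd [DecidableEq ι] (hg : ∀ i, Measurable (g i)) {L R : Finset ι}
    (hLR : Disjoint L R) {J J' : Set ℝ} (hJ : MeasurableSet J) (hJ' : MeasurableSet J') :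
    ProbabilityTheory.IndepFun (orderedProd A g L J) (orderedProd A g R J')
      (Measure.pi fun _ : ι => P) := by
  have h0 : ProbabilityTheory.iIndepFun (fun i (x : ι → ℝ) => x i) (Measure.pi fun _ : ι => P) :=
    ProbabilityTheory.iIndepFun_pi (X := fun _ => id) fun i => measurable_id.aemeasurable
  have h1 := h0.indepFun_finset L R hLR fun i => measurable_pi_apply i
  have hm : ∀ (S : Finset ι) {K : Set ℝ}, MeasurableSet K → Measurable fun y : S → ℝ =>
      orderedProd A g S K fun i => if h : i ∈ S then y ⟨i, h⟩ else 0 := by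
    intro S K hK
    refine (measurable_orderedProd hg S hK).comp (measurable_pi_lambda _ fun i => ?_)
    split_ifs
    · exact measurable_pi_apply _
    · exact measurable_const
  have h2 := h1.comp (hm L hJ) (hm R hJ')
  have e : ∀ (S : Finset ι) (K : Set ℝ), ((fun y : S → ℝ =>
      orderedProd A g S K fun i => if h : i ∈ S then y ⟨i, h⟩ else 0) ∘
      fun (x : ι → ℝ) (i : S) => x i) = orderedProd A g S K := by
    intro S K
    funext x
    rw [Function.comp_apply]
    exact orderedProd_congr (S := S) fun i hi => by rw [dif_pos hi]
  rwa [e, e] at h2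

theorem norm_integral_orderedProd_union_le [DecidableEq ι] (hg : ∀ i, Measurable (g i))
    (hgi : ∀ i, Integrable (g i) P) (S : Finset ι) {J J' : Set ℝ} (hJm : MeasurableSet J)
    (hJm' : MeasurableSet J') (hJ : ∀ y ∈ J, ∀ z ∈ J', y < z) :
    ‖∫ x, orderedProd A g S (J ∪ J') x ∂(Measure.pi fun _ : ι => P)‖ ≤ ∑ L ∈ S.powerset,
      ‖∫ x, orderedProd A g L J x ∂(Measure.pi fun _ : ι => P)‖ *
      ‖∫ x, orderedProd A g (S \ L) J' x ∂(Measure.pi fun _ : ι => P)‖ := by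
  simp only [orderedProd_union hJ]
  have hind : ∀ L : Finset ι, ProbabilityTheory.IndepFun (orderedProd A g L J)
      (orderedProd A g (S \ L) J') (Measure.pi fun _ : ι => P) := fun L =>
    indepFun_orderedProd hg Finset.disjoint_sdiff hJm hJm'
  have hint : ∀ L : Finset ι, Integrable
      (fun x => orderedProd A g L J x * orderedProd A g (S \ L) J' x)
      (Measure.pi fun _ : ι => P) := fun L =>
    (hind L).integrable_mul (integrable_orderedProd hg hgi _ hJm)
      (integrable_orderedProd hg hgi _ hJm')
  rw [integral_finsetSum _ fun L _ => (hint L).const_mul _]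
  refine (norm_sum_le _ _).trans (Finset.sum_le_sum fun L _ => ?_)
  rw [integral_const_mul, norm_mul, (hind L).integral_fun_mul_eq_mul_integral
    (measurable_orderedProd hg _ hJm).aestronglyMeasurable
    (measurable_orderedProd hg _ hJm').aestronglyMeasurable, norm_mul]
  refine mul_le_of_le_one_left (by positivity) ?_
  split_ifs <;> simp

end OrderedProd

/-! ### Common quantiles -/

/-- Quantile points common to finitely many densities `h i` of mass at most `1`. Adding the uniform
density makes the cumulative distribution strictly increasing, so quantiles are unique and hence
monotone in the parameter. -/
theorem exists_quantile {ι : Type*} [Fintype ι] {R : ℝ} (hR : 0 < R) (h : ι → ℝ → ℝ)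
    (h0 : ∀ i x, 0 ≤ h i x) (hint : ∀ i, IntegrableOn (h i) (Ioc 0 R))
    (h1 : ∀ i, ∫ x in Ioc 0 R, h i x ≤ 1) :
    ∃ U : ℝ → ℝ, Monotone U ∧ (∀ t, U t ∈ Icc 0 R) ∧ U 0 = 0 ∧ (∀ t, 1 ≤ t → U t = R) ∧
      ∀ i s t, s ≤ t → ∫ x in Ioc (U s) (U t), h i x ≤ (Fintype.card ι + 1) * (t - s) := by
  set w : ℝ → ℝ := fun x => ∑ i, h i x + R⁻¹ with hw
  have hcint : ∀ a b : ℝ, IntegrableOn (fun _ : ℝ => R⁻¹) (Ioc a b) := fun a b =>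
    integrableOn_const measure_Ioc_lt_top.ne
  have hwint : IntegrableOn w (Ioc 0 R) :=
    (integrable_finsetSum _ fun i _ => hint i).add (hcint 0 R)
  have hwii : ∀ a ∈ Icc 0 R, ∀ b ∈ Icc 0 R, IntervalIntegrable w volume a b := by
    intro a ha b hb
    have : IntervalIntegrable w volume 0 R :=
      (intervalIntegrable_iff_integrableOn_Ioc_of_le hR.le).2 hwint
    refine this.mono_set ?_
    rw [uIcc_of_le hR.le]
    exact uIcc_subset_Icc ha hb
  set φ : ℝ → ℝ := fun x => ∫ y in (0 : ℝ)..x, w y with hφ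
  have h0m : (0 : ℝ) ∈ Icc 0 R := ⟨le_rfl, hR.le⟩
  have hRm : R ∈ Icc 0 R := ⟨hR.le, le_rfl⟩
  have hdiff : ∀ a ∈ Icc 0 R, ∀ b ∈ Icc 0 R, a ≤ b → φ b - φ a = ∫ x in Ioc a b, w x := by
    intro a ha b hb hab
    rw [hφ, intervalIntegral.integral_interval_sub_left (hwii _ h0m _ hb) (hwii _ h0m _ ha),
      intervalIntegral.integral_of_le hab]
  have hsub : ∀ a ∈ Icc 0 R, ∀ b ∈ Icc 0 R, Ioc a b ⊆ Ioc 0 R := fun a ha b hb =>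
    Ioc_subset_Ioc ha.1 hb.2
  have hgrow : ∀ a ∈ Icc 0 R, ∀ b ∈ Icc 0 R, a < b → φ a < φ b := by
    intro a ha b hb hab
    have h2 : ∫ x in Ioc a b, R⁻¹ ≤ ∫ x in Ioc a b, w x := by
      refine setIntegral_mono (hcint a b) (hwint.mono_set (hsub a ha b hb)) fun x => ?_
      exact le_add_of_nonneg_left (Finset.sum_nonneg fun i _ => h0 i x)
    rw [← hdiff a ha b hb hab.le] at h2
    have h3 : ∫ x in Ioc a b, R⁻¹ = (b - a) * R⁻¹ := by
      simp [hab.le]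
    have : 0 < (b - a) * R⁻¹ := mul_pos (sub_pos.2 hab) (inv_pos.2 hR)
    linarith
  have hφ0 : φ 0 = 0 := by simp [hφ]
  have hΦ : φ R ≤ Fintype.card ι + 1 := by
    have := hdiff 0 h0m R hRm hR.le
    rw [hφ0, sub_zero] at this
    rw [this, hw, integral_add (integrable_finsetSum _ fun i _ => hint i) (hcint 0 R),
      integral_finsetSum _ fun i _ => hint i]
    have h2 : ∑ i, ∫ x in Ioc 0 R, h i x ≤ ∑ _i : ι, (1 : ℝ) := Finset.sum_le_sum fun i _ => h1 i
    have h3 : ∫ x in Ioc 0 R, R⁻¹ = 1 := by simp [hR.le, hR.ne']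
    rw [h3]
    simpa using h2
  have hΦ0 : 0 < φ R := hφ0 ▸ hgrow 0 h0m R hRm hR
  have hcont : ContinuousOn φ (Icc 0 R) := by
    have := intervalIntegral.continuousOn_primitive_interval (f := w) (a := 0) (b := R)
      (μ := volume) (by rw [uIcc_of_le hR.le, integrableOn_Icc_iff_integrableOn_Ioc]; exact hwint)
    rwa [uIcc_of_le hR.le] at this
  set cl : ℝ → ℝ := fun t => max 0 (min t 1) with hcl
  have hcl0 : ∀ t, 0 ≤ cl t := fun t => le_max_left _ _
  have hcl1 : ∀ t, cl t ≤ 1 := fun t => max_le zero_le_one (min_le_right _ _)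
  have hex : ∀ t : ℝ, ∃ u ∈ Icc 0 R, φ u = cl t * φ R := by
    intro t
    have := intermediate_value_Icc hR.le hcont
    have hm : cl t * φ R ∈ Icc (φ 0) (φ R) := by
      rw [hφ0]
      exact ⟨mul_nonneg (hcl0 t) hΦ0.le, mul_le_of_le_one_left hΦ0.le (hcl1 t)⟩
    obtain ⟨u, hu, hu'⟩ := this hm
    exact ⟨u, hu, hu'⟩
  choose U hU hUφ using hex
  have hclm : Monotone cl := fun s t hst => max_le_max le_rfl (min_le_min hst le_rfl)
  have hmono : Monotone U := by
    intro s t hst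
    by_contra hlt
    push Not at hlt
    have h2 := hgrow _ (hU t) _ (hU s) hlt
    rw [hUφ, hUφ] at h2
    exact absurd (mul_le_mul_of_nonneg_right (hclm hst) hΦ0.le) (not_le.2 h2)
  have hinj : ∀ a ∈ Icc 0 R, ∀ b ∈ Icc 0 R, φ a = φ b → a = b := by
    intro a ha b hb hab
    rcases lt_trichotomy a b with hlt | heq | hlt
    · exact absurd hab (hgrow a ha b hb hlt).ne
    · exact heq
    · exact absurd hab (hgrow b hb a ha hlt).ne'
  refine ⟨U, hmono, hU, ?_, fun t ht => ?_, fun i s t hst => ?_⟩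
  · refine hinj _ (hU 0) _ h0m ?_
    rw [hUφ, hφ0]; simp [hcl]
  · refine hinj _ (hU t) _ hRm ?_
    rw [hUφ]; simp [hcl, ht]
  · have hs := hsub _ (hU s) _ (hU t)
    have e1 : ∫ x in Ioc (U s) (U t), h i x ≤ ∫ x in Ioc (U s) (U t), w x := by
      refine setIntegral_mono ((hint i).mono_set hs) (hwint.mono_set hs) fun x => ?_
      have := Finset.single_le_sum (f := fun i => h i x) (fun i _ => h0 i x) (Finset.mem_univ i)
      have hR' := inv_pos.2 hR
      simp only [hw]
      linarith
    rw [← hdiff _ (hU s) _ (hU t) (hmono hst), hUφ, hUφ, ← sub_mul] at e1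
    refine e1.trans ?_
    have e2 : cl t - cl s ≤ t - s := by
      simp only [hcl]
      rcases le_total t 1 with a | a <;> rcases le_total s 1 with b | b <;>
      rcases le_total t 0 with c | c <;> rcases le_total s 0 with d | d <;>
      simp [a, b, c, d] <;> linarith
    have e3 : 0 ≤ cl t - cl s := sub_nonneg.2 (hclm hst)
    nlinarith [mul_le_mul e2 hΦ hΦ0.le (by linarith : 0 ≤ t - s)]

/-! ### Interpolation for a single kernel -/

/-- The inner integral of the layer-cake computation behind the interpolation argument. -/
theorem lintegral_indicator_mul_rpow_le {p q c y : ℝ} (hpq : p.HolderConjugate q) (hq : 2 < q)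
    (hc : 0 < c) (hy : 0 ≤ y) :
    ∫⁻ h in Ioi (0 : ℝ), ENNReal.ofReal (if y ^ (p - 1) * h ≤ c then y ^ 2 * h ^ (q - 3) else 0) ≤
      ENNReal.ofReal (c ^ (q - 2) / (q - 2) * y ^ p) := by
  rcases hy.eq_or_lt with rfl | hy
  · simp
  have hp := hpq.lt
  set T : ℝ := c * y ^ (1 - p) with hT
  have hT0 : 0 < T := mul_pos hc (Real.rpow_pos_of_pos hy _)
  have hyy : y ^ (p - 1) * y ^ (1 - p) = 1 := by
    rw [← Real.rpow_add hy]; simp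
  have e1 : ∫⁻ h in Ioi (0 : ℝ), ENNReal.ofReal
      (if y ^ (p - 1) * h ≤ c then y ^ 2 * h ^ (q - 3) else 0) ≤
      ∫⁻ h in Ioc 0 T, ENNReal.ofReal (y ^ 2 * h ^ (q - 3)) := by
    rw [← lintegral_indicator measurableSet_Ioi, ← lintegral_indicator measurableSet_Ioc]
    refine lintegral_mono fun h => ?_
    by_cases hh : 0 < h
    · rw [indicator_of_mem (show h ∈ Ioi (0 : ℝ) from hh)]
      split_ifs with hle
      · rw [indicator_of_mem]
        refine ⟨hh, ?_⟩
        have := mul_le_mul_of_nonneg_right hle (Real.rpow_nonneg hy.le (1 - p))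
        calc h = (y ^ (p - 1) * y ^ (1 - p)) * h := by rw [hyy, one_mul]
          _ = y ^ (p - 1) * h * y ^ (1 - p) := by ring
          _ ≤ T := this
      · simp
    · rw [indicator_of_notMem (show h ∉ Ioi (0 : ℝ) from hh)]
      exact zero_le
  refine e1.trans (le_of_eq ?_)
  have hii : IntervalIntegrable (fun h : ℝ => h ^ (q - 3)) volume 0 T :=
    intervalIntegral.intervalIntegrable_rpow' (by linarith)
  rw [← ofReal_integral_eq_lintegral_ofReal]
  · rw [integral_const_mul, ← intervalIntegral.integral_of_le hT0.le,
      integral_rpow (Or.inl (by linarith))]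
    congr 1
    have e : q - 3 + 1 = q - 2 := by ring
    rw [e, Real.zero_rpow (by linarith), sub_zero, hT,
      Real.mul_rpow hc.le (Real.rpow_nonneg hy.le _), ← Real.rpow_mul hy.le]
    have hmul := hpq.mul_eq_add
    have e2 : y ^ p = y ^ 2 * y ^ ((1 - p) * (q - 2)) := by
      rw [← Real.rpow_natCast, ← Real.rpow_add hy]
      congr 1
      push_cast
      linarith
    rw [e2]; ring
  · exact ((intervalIntegrable_iff_integrableOn_Ioc_of_le hT0.le).1 hii).const_mul _
  · refine (ae_restrict_iff' measurableSet_Ioc).2 (ae_of_all _ fun h hh => ?_)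
    exact mul_nonneg (sq_nonneg _) (Real.rpow_nonneg hh.1.le _)

theorem measurable_kernelOp {k : ℝ → ℝ → ℂ} (hk : Measurable (Function.uncurry k)) {f : ℝ → ℂ}
    (hf : Measurable f) : Measurable (kernelOp k f) := by
  have : StronglyMeasurable (Function.uncurry fun lam x => k lam x * f x) :=
    (hk.mul (hf.comp measurable_snd)).stronglyMeasurable
  exact (this.integral_prod_right (ν := volume.restrict (Ioi (0 : ℝ)))).measurable

theorem lintegral_kernelOp_sq_le {I : Set ℝ} {k : ℝ → ℝ → ℂ} {B : ℝ≥0} (h : L2Bound I k B)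
    {f : ℝ → ℂ} (hf : Measurable f) (hb : ∃ M : ℝ, ∀ x, ‖f x‖ ≤ M) (hc : HasCompactSupport f) :
    ∫⁻ lam in I, ‖kernelOp k f lam‖ₑ ^ (2 : ℝ) ≤
      (B : ℝ≥0∞) ^ (2 : ℝ) * ∫⁻ x in Ioi (0 : ℝ), ‖f x‖ₑ ^ (2 : ℝ) := by
  have h1 := h f hf hb hc
  have h2 := ENNReal.rpow_le_rpow h1 (zero_le_two : (0 : ℝ) ≤ 2)
  rw [ENNReal.mul_rpow_of_nonneg _ _ zero_le_two] at h2
  have e := fun (g : ℝ → ℂ) (μ : Measure ℝ) => eLpNorm_nnreal_pow_eq_lintegral (f := g) (μ := μ)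
    (p := 2) two_ne_zero
  simp only [ENNReal.coe_ofNat, NNReal.coe_ofNat] at e
  rwa [e, e] at h2

/-- Marcinkiewicz interpolation between `L² → L²` and `L¹ → L^∞`. At height `h` the function `f` is
split at the level `|f|^(p-1) h = c`, with `c` chosen so that the large part of `f` contributes at
most `h / 2` to `K f`. -/
theorem lintegral_kernelOp_rpow_le {p q : ℝ} (hpq : p.HolderConjugate q) (hq : 2 < q)
    (B₀ B₂ : ℝ≥0) (hB : 0 < B₀) : ∃ C : ℝ≥0, ∀ (I : Set ℝ) (k : ℝ → ℝ → ℂ),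
    Measurable (Function.uncurry k) → (∀ lam x, ‖k lam x‖ ≤ B₀) → L2Bound I k B₂ →
    ∀ (f : ℝ → ℂ) (R : ℝ), Measurable f → (∀ x, x ∉ Ioc 0 R → f x = 0) →
    Integrable (fun x => ‖f x‖ ^ p) (volume.restrict (Ioi 0)) →
    ∫⁻ lam in I, ‖kernelOp k f lam‖ₑ ^ q ≤
      C * ENNReal.ofReal ((∫ x in Ioi 0, ‖f x‖ ^ p) ^ (q - 1)) := by
  have hp1 := hpq.lt
  have hp0 : 0 < p := by linarith
  refine ⟨Real.toNNReal (q * (4 * B₂ ^ 2 * ((2 * B₀) ^ (q - 2) / (q - 2)))), ?_⟩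
  intro I k hk hkB hL2 f R hf hfR hfi
  set F : ℝ := ∫ x in Ioi 0, ‖f x‖ ^ p with hF
  have hFn : 0 ≤ F := integral_nonneg fun x => Real.rpow_nonneg (norm_nonneg _) _
  have hB' : (0 : ℝ) < B₀ := hB
  rcases hFn.eq_or_lt with hF0 | hF0
  · -- `f` vanishes almost everywhere
    have hz : (fun x => ‖f x‖ ^ p) =ᵐ[volume.restrict (Ioi 0)] 0 :=
      (integral_eq_zero_iff_of_nonneg (fun x => Real.rpow_nonneg (norm_nonneg _) _) hfi).1
        hF0.symm
    have hz2 : ∀ lam, kernelOp k f lam = 0 := by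
      intro lam
      refine integral_eq_zero_of_ae ?_
      filter_upwards [hz] with x hx
      have : f x = 0 := by
        have := (Real.rpow_eq_zero (norm_nonneg _) hp0.ne').1 hx
        simpa using this
      simp [this]
    simp only [hz2, enorm_zero, ENNReal.zero_rpow_of_pos (show 0 < q by linarith)]
    simp
  set c : ℝ := 2 * B₀ * F with hc
  have hc0 : 0 < c := by positivity
  have hfint : Integrable f (volume.restrict (Ioi 0)) := by
    have h1 : Integrable (fun x => (Ioc 0 R).indicator (fun _ => (1 : ℝ)) x + ‖f x‖ ^ p)
        (volume.restrict (Ioi 0)) := by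
      refine Integrable.add ?_ hfi
      refine (Integrable.restrict ?_)
      exact (integrable_indicator_iff measurableSet_Ioc).2
        (integrableOn_const measure_Ioc_lt_top.ne)
    refine h1.mono' hf.aestronglyMeasurable (ae_of_all _ fun x => ?_)
    by_cases hx : x ∈ Ioc 0 R
    · rw [indicator_of_mem hx]
      rcases le_total ‖f x‖ 1 with h | h
      · have := Real.rpow_nonneg (norm_nonneg (f x)) p
        linarith
      · have := Real.self_le_rpow_of_one_le h hp1.le
        linarith
    · rw [hfR x hx]
      simp only [norm_zero]
      have : 0 ≤ (Ioc 0 R).indicator (fun _ => (1 : ℝ)) x :=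
        indicator_nonneg (fun _ _ => zero_le_one) _
      have := Real.rpow_nonneg (le_refl (0 : ℝ)) p
      linarith
  have hkm : ∀ lam, Measurable (k lam) := fun lam => hk.comp measurable_prodMk_left
  have hmain : ∀ h : ℝ, 0 < h → (volume.restrict I) {lam | h < ‖kernelOp k f lam‖} *
      ENNReal.ofReal (h ^ (q - 1)) ≤ ENNReal.ofReal (4 * B₂ ^ 2) * ∫⁻ x in Ioi (0 : ℝ),
      ENNReal.ofReal (if ‖f x‖ ^ (p - 1) * h ≤ c then ‖f x‖ ^ 2 * h ^ (q - 3) else 0) := by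
    intro h hh
    set S : Set ℝ := {x | ‖f x‖ ^ (p - 1) * h ≤ c} with hS
    have hSm : MeasurableSet S :=
      measurableSet_le ((hf.norm.pow_const _).mul_const _) measurable_const
    have hbig : ∀ lam, ‖kernelOp k (Sᶜ.indicator f) lam‖ ≤ h / 2 := by
      intro lam
      have h1 : ‖kernelOp k (Sᶜ.indicator f) lam‖ ≤
          ∫ x in Ioi 0, B₀ * h / c * ‖f x‖ ^ p := by
        refine norm_integral_le_of_norm_le (hfi.const_mul _) (ae_of_all _ fun x => ?_)
        rw [norm_mul]
        have hnn : 0 ≤ B₀ * h / c * ‖f x‖ ^ p := by positivity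
        by_cases hx : x ∈ Sᶜ
        · rw [indicator_of_mem hx]
          have hx' : c < ‖f x‖ ^ (p - 1) * h := not_le.1 hx
          have hfx : ‖f x‖ ≠ 0 := by
            intro h0
            rw [h0, Real.zero_rpow (by linarith), zero_mul] at hx'
            linarith
          have e : ‖f x‖ ^ p = ‖f x‖ ^ (p - 1) * ‖f x‖ := by
            rw [Real.rpow_sub_one hfx]; field_simp
          calc ‖k lam x‖ * ‖f x‖ ≤ B₀ * ‖f x‖ :=
                mul_le_mul_of_nonneg_right (hkB _ _) (norm_nonneg _)
            _ = B₀ * (c / c) * ‖f x‖ := by rw [div_self hc0.ne', mul_one]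
            _ ≤ B₀ * ((‖f x‖ ^ (p - 1) * h) / c) * ‖f x‖ := by gcongr
            _ = B₀ * h / c * ‖f x‖ ^ p := by rw [e]; ring
        · rw [indicator_of_notMem hx, norm_zero, mul_zero]
          exact hnn
      rw [integral_const_mul, ← hF] at h1
      refine h1.trans (le_of_eq ?_)
      rw [hc]; field_simp
    have hsplit : ∀ lam, kernelOp k f lam =
        kernelOp k (S.indicator f) lam + kernelOp k (Sᶜ.indicator f) lam := by
      intro lam
      have hi : ∀ g : ℝ → ℂ, Integrable g (volume.restrict (Ioi 0)) →
          Integrable (fun x => k lam x * g x) (volume.restrict (Ioi 0)) := fun g hg =>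
        hg.bdd_mul (hkm lam).aestronglyMeasurable (ae_of_all _ (hkB lam))
      unfold kernelOp
      rw [← integral_add (hi _ (hfint.indicator hSm)) (hi _ (hfint.indicator hSm.compl))]
      congr 1
      funext x
      rw [← mul_add]
      congr 1
      exact (congrFun (indicator_self_add_compl S f) x).symm
    have hsub : {lam | h < ‖kernelOp k f lam‖} ⊆ {lam | ENNReal.ofReal ((h / 2) ^ 2) ≤
        ‖kernelOp k (S.indicator f) lam‖ₑ ^ (2 : ℝ)} := by
      intro lam hlam
      have hlam : h < ‖kernelOp k f lam‖ := hlam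
      have h2 : h / 2 ≤ ‖kernelOp k (S.indicator f) lam‖ := by
        have := norm_add_le (kernelOp k (S.indicator f) lam) (kernelOp k (Sᶜ.indicator f) lam)
        rw [← hsplit] at this
        linarith [hbig lam]
      change ENNReal.ofReal ((h / 2) ^ 2) ≤ ‖kernelOp k (S.indicator f) lam‖ₑ ^ (2 : ℝ)
      rw [← ofReal_norm, ENNReal.ofReal_rpow_of_nonneg (norm_nonneg _) zero_le_two]
      refine ENNReal.ofReal_le_ofReal ?_
      rw [Real.rpow_two]
      exact pow_le_pow_left₀ (by positivity) h2 2
    have hcheb := mul_meas_ge_le_lintegral (μ := volume.restrict I)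
      (((measurable_kernelOp hk (hf.indicator hSm)).enorm).pow_const (2 : ℝ))
      (ENNReal.ofReal ((h / 2) ^ 2))
    have hL := lintegral_kernelOp_sq_le hL2 (hf.indicator hSm)
      ⟨(c / h) ^ (p - 1)⁻¹, fun x => by
        by_cases hx : x ∈ S
        · rw [indicator_of_mem hx]
          rw [Real.le_rpow_inv_iff_of_pos (norm_nonneg _) (by positivity) (by linarith),
            le_div_iff₀ hh]
          exact hx
        · rw [indicator_of_notMem hx, norm_zero]
          positivity⟩
      (HasCompactSupport.intro (isCompact_Icc (a := 0) (b := R)) fun x hx => by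
        have : f x = 0 := hfR x fun h => hx ⟨h.1.le, h.2⟩
        by_cases hxs : x ∈ S <;> simp [hxs, this])
    have hν : ENNReal.ofReal ((h / 2) ^ 2) * (volume.restrict I) {lam | h < ‖kernelOp k f lam‖} ≤
        (B₂ : ℝ≥0∞) ^ (2 : ℝ) * ∫⁻ x in Ioi (0 : ℝ), ‖S.indicator f x‖ₑ ^ (2 : ℝ) :=
      (mul_le_mul_right (measure_mono hsub) _).trans (hcheb.trans hL)
    have hx2 : ∀ x, ENNReal.ofReal (h ^ (q - 3)) * ‖S.indicator f x‖ₑ ^ (2 : ℝ) = ENNReal.ofReal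
        (if ‖f x‖ ^ (p - 1) * h ≤ c then ‖f x‖ ^ 2 * h ^ (q - 3) else 0) := by
      intro x
      by_cases hx : x ∈ S
      · rw [indicator_of_mem hx, if_pos (show ‖f x‖ ^ (p - 1) * h ≤ c from hx),
          ← ofReal_norm, ENNReal.ofReal_rpow_of_nonneg (norm_nonneg _) zero_le_two,
          Real.rpow_two, mul_comm, ENNReal.ofReal_mul (sq_nonneg _)]
      · rw [indicator_of_notMem hx, if_neg (show ¬ ‖f x‖ ^ (p - 1) * h ≤ c from hx)]
        simp
    have hx3 : ∫⁻ x in Ioi (0 : ℝ), ENNReal.ofReal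
        (if ‖f x‖ ^ (p - 1) * h ≤ c then ‖f x‖ ^ 2 * h ^ (q - 3) else 0) =
        ENNReal.ofReal (h ^ (q - 3)) * ∫⁻ x in Ioi (0 : ℝ), ‖S.indicator f x‖ₑ ^ (2 : ℝ) := by
      rw [← lintegral_const_mul _ (((hf.indicator hSm).enorm).pow_const (2 : ℝ))]
      simp only [hx2]
    have hpw : ENNReal.ofReal (h ^ (q - 1)) = ENNReal.ofReal 4 * ENNReal.ofReal (h ^ (q - 3)) *
        ENNReal.ofReal ((h / 2) ^ 2) := by
      rw [← ENNReal.ofReal_mul (by norm_num), ← ENNReal.ofReal_mul (by positivity)]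
      congr 1
      have : h ^ (q - 1) = h ^ (q - 3) * h ^ 2 := by
        rw [← Real.rpow_natCast, ← Real.rpow_add hh]; congr 1; push_cast; ring
      rw [this]; ring
    rw [hx3, hpw]
    calc _ = ENNReal.ofReal 4 * ENNReal.ofReal (h ^ (q - 3)) * (ENNReal.ofReal ((h / 2) ^ 2) *
          (volume.restrict I) {lam | h < ‖kernelOp k f lam‖}) := by ring
      _ ≤ ENNReal.ofReal 4 * ENNReal.ofReal (h ^ (q - 3)) * ((B₂ : ℝ≥0∞) ^ (2 : ℝ) *
          ∫⁻ x in Ioi (0 : ℝ), ‖S.indicator f x‖ₑ ^ (2 : ℝ)) := by gcongr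
      _ = _ := by
        rw [ENNReal.ofReal_mul (by norm_num), ENNReal.ofReal_pow (by positivity),
          ENNReal.ofReal_coe_nnreal, ENNReal.rpow_two]
        ring
  have hlc := lintegral_rpow_eq_lintegral_meas_lt_mul (volume.restrict I)
    (f := fun lam => ‖kernelOp k f lam‖) (ae_of_all _ fun _ => norm_nonneg _)
    (measurable_kernelOp hk hf).norm.aemeasurable (p := q) (by linarith)
  have hconv : ∫⁻ lam in I, ‖kernelOp k f lam‖ₑ ^ q =
      ∫⁻ lam in I, ENNReal.ofReal (‖kernelOp k f lam‖ ^ q) := by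
    refine lintegral_congr fun lam => ?_
    rw [← ofReal_norm, ENNReal.ofReal_rpow_of_nonneg (norm_nonneg _) (by linarith)]
  have hjm : Measurable fun z : ℝ × ℝ => ENNReal.ofReal
      (if ‖f z.2‖ ^ (p - 1) * z.1 ≤ c then ‖f z.2‖ ^ 2 * z.1 ^ (q - 3) else 0) := by
    have hf2 : Measurable fun z : ℝ × ℝ => f z.2 := hf.comp measurable_snd
    refine (Measurable.ite ?_ ?_ measurable_const).ennreal_ofReal
    · exact measurableSet_le ((hf2.norm.pow_const _).mul measurable_fst) measurable_const
    · exact (hf2.norm.pow_const _).mul (measurable_fst.pow_const _)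
  rw [hconv, hlc]
  calc _ ≤ ENNReal.ofReal q * ∫⁻ h in Ioi (0 : ℝ), ENNReal.ofReal (4 * B₂ ^ 2) *
        ∫⁻ x in Ioi (0 : ℝ), ENNReal.ofReal
          (if ‖f x‖ ^ (p - 1) * h ≤ c then ‖f x‖ ^ 2 * h ^ (q - 3) else 0) := by
        refine mul_le_mul_right (setLIntegral_mono' measurableSet_Ioi fun h hh => ?_) _
        exact hmain h hh
    _ = ENNReal.ofReal q * (ENNReal.ofReal (4 * B₂ ^ 2) * ∫⁻ x in Ioi (0 : ℝ),
        ∫⁻ h in Ioi (0 : ℝ), ENNReal.ofReal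
          (if ‖f x‖ ^ (p - 1) * h ≤ c then ‖f x‖ ^ 2 * h ^ (q - 3) else 0)) := by
        rw [lintegral_const_mul' _ _ ENNReal.ofReal_ne_top]
        congr 2
        exact lintegral_lintegral_swap hjm.aemeasurable
    _ ≤ ENNReal.ofReal q * (ENNReal.ofReal (4 * B₂ ^ 2) * ∫⁻ x in Ioi (0 : ℝ),
        ENNReal.ofReal (c ^ (q - 2) / (q - 2) * ‖f x‖ ^ p)) := by
        gcongr with x
        exact lintegral_indicator_mul_rpow_le hpq hq hc0 (norm_nonneg _)
    _ = _ := by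
        have hq2 : 0 < q - 2 := by linarith
        rw [← ofReal_integral_eq_lintegral_ofReal (hfi.const_mul _)
          (ae_of_all _ fun x => by positivity), integral_const_mul, ← hF,
          ← ENNReal.ofReal_mul (by positivity), ← ENNReal.ofReal_mul (by linarith)]
        rw [ENNReal.ofNNReal_toNNReal, ← ENNReal.ofReal_mul (by positivity)]
        congr 1
        have e : F ^ (q - 1) = F ^ (q - 2) * F := by
          rw [← Real.rpow_add_one hF0.ne']; congr 1; ring
        rw [e, hc, Real.mul_rpow (by positivity) hF0.le]
        ring

/-! ### Dyadic majorants and the deterministic bound -/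

/-- The descendants of the node `(m, j)` of the dyadic tree. -/
def dyadicDesc (m j : ℕ) : Set (ℕ × ℕ) := {z | m ≤ z.1 ∧ z.2 / 2 ^ (z.1 - m) = j}

theorem mem_dyadicDesc_self (m j : ℕ) : (m, j) ∈ dyadicDesc m j := by simp [dyadicDesc]

theorem dyadicDesc_succ_subset (m j i : ℕ) (hi : i / 2 = j) :
    dyadicDesc (m + 1) i ⊆ dyadicDesc m j := by
  rintro ⟨a, c⟩ ⟨h1, h2⟩
  obtain ⟨d, rfl⟩ := Nat.exists_eq_add_of_le h1
  simp only at h2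
  refine ⟨by simp only; omega, ?_⟩
  have e1 : m + 1 + d - (m + 1) = d := by omega
  have e2 : m + 1 + d - m = d + 1 := by omega
  rw [e1] at h2
  simp only [e2, pow_succ, ← Nat.div_div_eq_div_mul, h2, hi]

/-- A weighted sum over all descendants of a node dominates the term of the node itself, and is
superadditive over its two children. The weights `2 ^ (δ m)` yield a gain in each generation that
makes the sum of the *squares* decay, although only `q`-th powers are summed. -/
theorem exists_dyadic_majorant {q δ : ℝ} (hq : 2 < q) {α : ℕ → ℕ → ℝ}
    (hα : ∀ m j, 0 ≤ α m j)
    (hs : Summable fun z : ℕ × ℕ => (2 : ℝ) ^ (δ * z.1) * α z.1 z.2) :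
    ∃ b : ℕ → ℕ → ℝ, (∀ m j, 0 ≤ b m j) ∧
      (∀ m j, b (m + 1) (2 * j) ^ 2 + b (m + 1) (2 * j + 1) ^ 2 ≤
        ((2 : ℝ) ^ ((q / 2 - 1 - δ) / q)) ^ 2 * b m j ^ 2) ∧
      (∀ m j, α m j ≤ b m j ^ q) ∧
      b 0 0 ^ q ≤ ∑' z : ℕ × ℕ, (2 : ℝ) ^ (δ * z.1) * α z.1 z.2 := by
  set ω : ℕ × ℕ → ℝ := fun z => (2 : ℝ) ^ (δ * z.1) * α z.1 z.2 with hω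
  have hω0 : ∀ z, 0 ≤ ω z := fun z => mul_nonneg (by positivity) (hα _ _)
  set W : ℕ → ℕ → ℝ := fun m j => ∑' z, (dyadicDesc m j).indicator ω z with hW
  have hsi : ∀ m j, Summable ((dyadicDesc m j).indicator ω) := fun m j => hs.indicator _
  have hi0 : ∀ m j z, 0 ≤ (dyadicDesc m j).indicator ω z := fun m j z =>
    indicator_nonneg (fun z _ => hω0 z) z
  have hW0 : ∀ m j, 0 ≤ W m j := fun m j => tsum_nonneg (hi0 m j)
  have hWadd : ∀ m j, W (m + 1) (2 * j) + W (m + 1) (2 * j + 1) ≤ W m j := by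
    intro m j
    rw [hW, ← (hsi _ _).tsum_add (hsi _ _)]
    refine ((hsi _ _).add (hsi _ _)).tsum_le_tsum (fun z => ?_) (hsi _ _)
    have hl := dyadicDesc_succ_subset m j (2 * j) (by omega)
    have hr := dyadicDesc_succ_subset m j (2 * j + 1) (by omega)
    by_cases h1 : z ∈ dyadicDesc (m + 1) (2 * j)
    · have h2 : z ∉ dyadicDesc (m + 1) (2 * j + 1) := by
        intro h2
        have := h1.2.symm.trans h2.2
        omega
      rw [indicator_of_mem h1, indicator_of_notMem h2, indicator_of_mem (hl h1), add_zero]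
    · rw [indicator_of_notMem h1, zero_add]
      exact indicator_le_indicator_of_subset hr hω0 z
  have hWself : ∀ m j : ℕ, (2 : ℝ) ^ (δ * m) * α m j ≤ W m j := by
    intro m j
    have := (hsi m j).le_tsum (m, j) fun z _ => hi0 m j z
    rwa [indicator_of_mem (mem_dyadicDesc_self m j)] at this
  have hq0 : 0 < q := by linarith
  set V : ℕ → ℕ → ℝ := fun m j => (2 : ℝ) ^ (-(δ * m)) * W m j with hV
  have hV0 : ∀ m j, 0 ≤ V m j := fun m j => mul_nonneg (by positivity) (hW0 m j)
  have hbq : ∀ m j, (V m j ^ q⁻¹) ^ q = V m j := fun m j => Real.rpow_inv_rpow (hV0 m j) hq0.ne'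
  refine ⟨fun m j => V m j ^ q⁻¹, fun m j => Real.rpow_nonneg (hV0 m j) _, fun m j => ?_,
    fun m j => ?_, ?_⟩
  · set x := V (m + 1) (2 * j) ^ q⁻¹ with hx
    set y := V (m + 1) (2 * j + 1) ^ q⁻¹ with hy
    set z := V m j ^ q⁻¹ with hz
    have hx0 : 0 ≤ x := Real.rpow_nonneg (hV0 _ _) _
    have hy0 : 0 ≤ y := Real.rpow_nonneg (hV0 _ _) _
    have hz0 : 0 ≤ z := Real.rpow_nonneg (hV0 _ _) _
    have h1 : x ^ q + y ^ q ≤ 2 ^ (-δ) * z ^ q := by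
      rw [hbq, hbq, hbq, hV]
      simp only
      have e : (2 : ℝ) ^ (-(δ * ((m + 1 : ℕ) : ℝ))) = 2 ^ (-δ) * 2 ^ (-(δ * m)) := by
        rw [← Real.rpow_add two_pos]; congr 1; push_cast; ring
      rw [e, ← mul_add, mul_assoc]
      gcongr
      exact hWadd m j
    have hsq : ∀ u : ℝ, 0 ≤ u → (u ^ 2) ^ (q / 2) = u ^ q := by
      intro u hu
      rw [← Real.rpow_natCast, ← Real.rpow_mul hu]; congr 1; push_cast; ring
    have h2 : (x ^ 2 + y ^ 2) ^ (q / 2) ≤ 2 ^ (q / 2 - 1) * (x ^ q + y ^ q) := by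
      have := NNReal.rpow_add_le_mul_rpow_add_rpow ⟨x ^ 2, sq_nonneg x⟩ ⟨y ^ 2, sq_nonneg y⟩
        (p := q / 2) (by linarith)
      have : (x ^ 2 + y ^ 2) ^ (q / 2) ≤
          2 ^ (q / 2 - 1) * ((x ^ 2) ^ (q / 2) + (y ^ 2) ^ (q / 2)) := mod_cast this
      rwa [hsq x hx0, hsq y hy0] at this
    have h3 : (((2 : ℝ) ^ ((q / 2 - 1 - δ) / q)) ^ 2 * z ^ 2) ^ (q / 2) =
        2 ^ (q / 2 - 1) * (2 ^ (-δ) * z ^ q) := by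
      rw [← mul_pow, hsq _ (by positivity), Real.mul_rpow (by positivity) hz0,
        ← Real.rpow_mul zero_le_two, ← mul_assoc, ← Real.rpow_add two_pos]
      congr 2
      field_simp
      ring
    refine (Real.rpow_le_rpow_iff (by positivity) (by positivity)
      (show 0 < q / 2 by linarith)).1 ?_
    rw [h3]
    exact h2.trans (mul_le_mul_of_nonneg_left h1 (by positivity))
  · simp only
    rw [hbq]
    have := mul_le_mul_of_nonneg_left (hWself m j) (show (0 : ℝ) ≤ 2 ^ (-(δ * m)) by positivity)
    rwa [← mul_assoc, ← Real.rpow_add two_pos, neg_add_cancel, Real.rpow_zero, one_mul] at this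
  · simp only
    rw [hbq, hV]
    simp only [Nat.cast_zero, mul_zero, neg_zero, Real.rpow_zero, one_mul]
    exact (hsi 0 0).tsum_le_tsum (fun z => indicator_le_self' (fun z _ => hω0 z) z) hs

/-- The `j`-th interval of generation `m` in the dyadic partition with quantile function `U`. -/
def dyadicIoc (U : ℝ → ℝ) (m j : ℕ) : Set ℝ :=
  Ioc (U ((j : ℝ) / 2 ^ m)) (U (((j : ℝ) + 1) / 2 ^ m))

theorem dyadicIoc_left (U : ℝ → ℝ) (m j : ℕ) : dyadicIoc U (m + 1) (2 * j) =
    Ioc (U ((j : ℝ) / 2 ^ m)) (U ((2 * (j : ℝ) + 1) / 2 ^ (m + 1))) := by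
  unfold dyadicIoc
  have : ((2 * j : ℕ) : ℝ) / 2 ^ (m + 1) = (j : ℝ) / 2 ^ m := by
    push_cast; rw [pow_succ]; field_simp
  rw [this]; push_cast; rfl

theorem dyadicIoc_right (U : ℝ → ℝ) (m j : ℕ) : dyadicIoc U (m + 1) (2 * j + 1) =
    Ioc (U ((2 * (j : ℝ) + 1) / 2 ^ (m + 1))) (U (((j : ℝ) + 1) / 2 ^ m)) := by
  unfold dyadicIoc
  have : (((2 * j + 1 : ℕ) : ℝ) + 1) / 2 ^ (m + 1) = ((j : ℝ) + 1) / 2 ^ m := by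
    push_cast; rw [pow_succ]; field_simp; ring
  rw [this]; push_cast; rfl

theorem dyadicIoc_eq_union {U : ℝ → ℝ} (hU : Monotone U) (m j : ℕ) :
    dyadicIoc U m j = dyadicIoc U (m + 1) (2 * j) ∪ dyadicIoc U (m + 1) (2 * j + 1) := by
  rw [dyadicIoc_left, dyadicIoc_right, Ioc_union_Ioc_eq_Ioc]
  · rfl
  · refine hU ?_
    rw [pow_succ, div_le_div_iff₀ (by positivity) (by positivity)]
    have : (0 : ℝ) < 2 ^ m := by positivity
    nlinarith
  · refine hU ?_
    rw [pow_succ, div_le_div_iff₀ (by positivity) (by positivity)]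
    have : (0 : ℝ) < 2 ^ m := by positivity
    nlinarith

theorem measurableSet_dyadicIoc (U : ℝ → ℝ) (m j : ℕ) : MeasurableSet (dyadicIoc U m j) :=
  measurableSet_Ioc

/-- Deterministic bound for the truncated multilinear integral, given a majorant `b` of the dyadic
increments `∫ G i` whose squares decay geometrically along the dyadic tree. -/
theorem exists_orderedProd_bound (ι : Type*) [Fintype ι] [Nonempty ι] {θ : ℝ} (hθ0 : 0 ≤ θ)
    (hθ1 : θ < 1) : ∃ C : ℝ, 0 ≤ C ∧ ∀ (P : Measure ℝ) [IsProbabilityMeasure P]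
    (A : Finset (ι × ι)) (G : ι → ℝ → ℂ) (D : ι → ℝ≥0∞) (U : ℝ → ℝ) (b : ℕ → ℕ → ℝ) (E σ : ℝ),
    (∀ i, Measurable (G i)) → (∀ i, Integrable (G i) P) → Monotone U → (∀ m j, 0 ≤ b m j) →
    (∀ m j, b (m + 1) (2 * j) ^ 2 + b (m + 1) (2 * j + 1) ^ 2 ≤ θ ^ 2 * b m j ^ 2) →
    (∀ i m j, ‖∫ x in dyadicIoc U m j, G i x ∂P‖ ≤ b m j) →
    0 ≤ E → 0 ≤ σ → 2 * σ ^ 2 < 1 → (∀ i m j, ∫ x in dyadicIoc U m j, ‖G i x‖ ∂P ≤ E * σ ^ m) →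
    ‖∫ x, orderedProd A (fun i => {x : ℝ | ENNReal.ofReal x < D i}.indicator (G i)) Finset.univ
      (dyadicIoc U 0 0) x ∂(Measure.pi fun _ : ι => P)‖ ≤ C * b 0 0 ^ Fintype.card ι := by
  classical
  obtain ⟨C, hC0, hC⟩ := tree_bound (ι := ι) (θ := θ) (c := (1 - θ)⁻¹) (by nlinarith) hθ0
    (inv_nonneg.2 (by linarith)) (Fintype.card ι)
  refine ⟨C, hC0, ?_⟩
  intro P _ A G D U b E σ hG hGi hU hb hb2 hbG hE0 hσ0 hσ1 hGE
  have hσlt : σ < 1 := by nlinarith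
  set g : ι → ℝ → ℂ := fun i => {x : ℝ | ENNReal.ofReal x < D i}.indicator (G i) with hg
  have hDm : ∀ i, MeasurableSet {x : ℝ | ENNReal.ofReal x < D i} := fun i =>
    measurableSet_lt ENNReal.measurable_ofReal measurable_const
  have hgm : ∀ i, Measurable (g i) := fun i => (hG i).indicator (hDm i)
  have hgi : ∀ i, Integrable (g i) P := fun i => (hGi i).indicator (hDm i)
  have hgn : ∀ i x, ‖g i x‖ ≤ ‖G i x‖ := fun i x => norm_indicator_le_norm_self _ _
  have hJm := measurableSet_dyadicIoc U
  have hgE : ∀ i m j, ∫ x in dyadicIoc U m j, ‖g i x‖ ∂P ≤ E * σ ^ m := fun i m j =>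
    (setIntegral_mono (hgi i).norm.integrableOn (hGi i).norm.integrableOn (hgn i)).trans
      (hGE i m j)
  have hsing : ∀ i m j, ‖∫ x in dyadicIoc U m j, g i x ∂P‖ ≤ (1 - θ)⁻¹ * b m j := by
    intro i
    refine branch_bound hθ0 hθ1 hb hb2 hσ0 hσlt
      (fun m j => (norm_integral_le_integral_norm _).trans (hgE i m j)) fun m j => ?_
    have hdisj : Disjoint (dyadicIoc U (m + 1) (2 * j)) (dyadicIoc U (m + 1) (2 * j + 1)) := by
      rw [dyadicIoc_left, dyadicIoc_right]
      exact Ioc_disjoint_Ioc_of_le le_rfl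
    have hsum : ∫ x in dyadicIoc U m j, g i x ∂P = ∫ x in dyadicIoc U (m + 1) (2 * j), g i x ∂P +
        ∫ x in dyadicIoc U (m + 1) (2 * j + 1), g i x ∂P := by
      rw [dyadicIoc_eq_union hU, setIntegral_union hdisj (hJm _ _) (hgi i).integrableOn
        (hgi i).integrableOn]
    set d := U ((2 * (j : ℝ) + 1) / 2 ^ (m + 1)) with hd
    rcases le_or_gt (D i) (ENNReal.ofReal d) with h | h
    · left
      rw [hsum]
      have : ∫ x in dyadicIoc U (m + 1) (2 * j + 1), g i x ∂P = 0 := by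
        refine setIntegral_eq_zero_of_forall_eq_zero fun x hx => indicator_of_notMem ?_ _
        rw [dyadicIoc_right] at hx
        exact not_lt.2 (h.trans (ENNReal.ofReal_le_ofReal hx.1.le))
      rw [this, add_zero]
    · right
      rw [hsum]
      have : ∫ x in dyadicIoc U (m + 1) (2 * j), g i x ∂P =
          ∫ x in dyadicIoc U (m + 1) (2 * j), G i x ∂P := by
        refine setIntegral_congr_fun (hJm _ _) fun x hx => indicator_of_mem ?_ _
        rw [dyadicIoc_left] at hx
        exact (ENNReal.ofReal_le_ofReal hx.2).trans_lt h
      rw [this]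
      exact (norm_add_le _ _).trans (add_le_add_left (hbG i _ _) _)
  have := hC b hb hb2 (fun S m j => ‖∫ x, orderedProd A g S (dyadicIoc U m j) x
      ∂(Measure.pi fun _ : ι => P)‖) (fun S m j => norm_nonneg _) (fun m j => ?_)
    (fun S m j => ?_) (fun i m j => ?_) (σ ^ 2) (sq_nonneg σ) hσ1 (fun S hS => ?_) Finset.univ
    (Finset.card_pos.2 Finset.univ_nonempty) (by simp) 0 0
  · simpa using this
  · simp [orderedProd]
  · rw [dyadicIoc_eq_union hU m j]
    refine norm_integral_orderedProd_union_le hgm hgi S (hJm _ _) (hJm _ _) ?_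
    intro y hy z hz
    rw [dyadicIoc_left] at hy
    rw [dyadicIoc_right] at hz
    exact hy.2.trans_lt hz.1
  · exact (norm_integral_orderedProd_singleton_le hgm i (hJm _ _)).trans (hsing i m j)
  · refine ⟨E ^ S.card, fun m j => ?_⟩
    refine (norm_integral_orderedProd_le_prod hgm hgi S (hJm _ _)).trans ?_
    calc _ ≤ ∏ _i ∈ S, E * σ ^ m := Finset.prod_le_prod
          (fun i _ => integral_nonneg fun x => norm_nonneg _) fun i _ => hgE i m j
      _ = E ^ S.card * (σ ^ m) ^ S.card := by rw [Finset.prod_const, mul_pow]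
      _ ≤ E ^ S.card * (σ ^ m) ^ 2 := by
          refine mul_le_mul_of_nonneg_left ?_ (by positivity)
          exact pow_le_pow_of_le_one (by positivity) (pow_le_one₀ hσ0 hσlt.le) hS
      _ = E ^ S.card * (σ ^ 2) ^ m := by ring

/-! ### Truncated integrals as ordered products -/

theorem multilinearIntegrand_truncKernel_eq_orderedProd {n : ℕ} {k : Fin n → ℝ → ℝ → ℂ}
    {A : Finset (Fin n × Fin n)} {f : Fin n → ℝ → ℂ} {D : Fin n → ℝ≥0∞} {lam : ℝ} {J : Set ℝ}
    {x : Fin n → ℝ} (hx : ∀ i, x i ∈ J) :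
    multilinearIntegrand (truncKernel k D) A f lam x =
      orderedProd A (fun i => {y : ℝ | ENNReal.ofReal y < D i}.indicator
        fun y => k i lam y * f i y) Finset.univ J x := by
  classical
  unfold multilinearIntegrand orderedProd truncKernel
  have h1 : ∀ α ∈ A, (Ioi (0 : ℝ)).indicator (fun _ => (1 : ℂ)) (x α.1 - x α.2) =
      if x α.2 < x α.1 then 1 else 0 := by
    intro α _
    by_cases h : x α.2 < x α.1 <;> simp [indicator, h]
  rw [Finset.prod_congr rfl h1, Finset.prod_ite_zero, Finset.prod_const_one]
  simp only [Finset.mem_univ, true_imp_iff]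
  have h2 : ∀ i, J.indicator ({y : ℝ | ENNReal.ofReal y < D i}.indicator
      fun y => k i lam y * f i y) (x i) =
      {x : ℝ | ENNReal.ofReal x < D i}.indicator (k i lam) (x i) * f i (x i) := by
    intro i
    rw [indicator_of_mem (hx i)]
    by_cases h : x i ∈ {x : ℝ | ENNReal.ofReal x < D i} <;> simp only [h, indicator_of_mem,
      indicator_of_notMem, not_false_eq_true, zero_mul]
  simp only [h2]
  split_ifs <;> simp

theorem pi_smul_measure {ι : Type*} [Fintype ι] (μ : Measure ℝ) [IsFiniteMeasure μ] {c : ℝ≥0∞}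
    (hc : c ≠ ∞) :
    Measure.pi (fun _ : ι => c • μ) = c ^ Fintype.card ι • Measure.pi fun _ : ι => μ := by
  have : IsFiniteMeasure (c • μ) := μ.smul_finite hc
  refine (Measure.pi_eq (μ := fun _ : ι => c • μ) fun s _ => ?_)
  rw [Measure.smul_apply, Measure.pi_pi, smul_eq_mul]
  simp only [Measure.smul_apply, smul_eq_mul, Finset.prod_mul_distrib, Finset.prod_const,
    Finset.card_univ]

/-- The uniform probability measure on `(0, R]`. -/
noncomputable def uniformIoc (R : ℝ) : Measure ℝ :=
  (ENNReal.ofReal R)⁻¹ • volume.restrict (Ioc 0 R)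

theorem isProbabilityMeasure_uniformIoc {R : ℝ} (hR : 0 < R) :
    IsProbabilityMeasure (uniformIoc R) := by
  refine ⟨?_⟩
  rw [uniformIoc, Measure.smul_apply, Measure.restrict_apply_univ, Real.volume_Ioc, sub_zero,
    smul_eq_mul, ENNReal.inv_mul_cancel (by simpa using hR) ENNReal.ofReal_ne_top]

theorem setIntegral_uniformIoc {E : Type*} [NormedAddCommGroup E] [NormedSpace ℝ E] {R : ℝ}
    (hR : 0 < R) {J : Set ℝ} (hJ : MeasurableSet J) (hJR : J ⊆ Ioc 0 R) (F : ℝ → E) :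
    ∫ x in J, F x ∂(uniformIoc R) = R⁻¹ • ∫ x in J, F x := by
  rw [uniformIoc, Measure.restrict_smul, integral_smul_measure, ENNReal.toReal_inv,
    ENNReal.toReal_ofReal hR.le, Measure.restrict_restrict hJ, inter_eq_left.2 hJR]

theorem orderedProd_const_mul {ι : Type*} [Fintype ι] {A : Finset (ι × ι)} (c : ℂ)
    (g : ι → ℝ → ℂ) (J : Set ℝ) (x : ι → ℝ) :
    orderedProd A (fun i y => c * g i y) Finset.univ J x =
      c ^ Fintype.card ι * orderedProd A g Finset.univ J x := by
  classical
  unfold orderedProd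
  split_ifs
  · have : ∀ i, J.indicator (fun y => c * g i y) (x i) = c * J.indicator (g i) (x i) := by
      intro i
      by_cases h : x i ∈ J <;> simp [h]
    simp only [this, Finset.prod_mul_distrib, Finset.prod_const, Finset.card_univ]
  · simp

/-- The factors `R` in the integrand compensate the normalization of the uniform measure, for which
inactive variables integrate to `1`. -/
theorem multilinearOp_truncKernel_eq {n : ℕ} {k : Fin n → ℝ → ℝ → ℂ}
    {A : Finset (Fin n × Fin n)} {f : Fin n → ℝ → ℂ} {D : Fin n → ℝ≥0∞} {lam R : ℝ} (hR : 0 < R)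
    (hD : ∀ i, D i ≤ ENNReal.ofReal R) :
    multilinearOp (truncKernel k D) A f lam =
      ∫ x, orderedProd A (fun i => {y : ℝ | ENNReal.ofReal y < D i}.indicator
        fun y => (R : ℂ) * (k i lam y * f i y)) Finset.univ (Ioc 0 R) x
        ∂(Measure.pi fun _ : Fin n => uniformIoc R) := by
  have hc : (ENNReal.ofReal R)⁻¹ ≠ ∞ := ENNReal.inv_ne_top.2 (by simpa using hR)
  have h1 : ∀ x : Fin n → ℝ, orderedProd A (fun i => {y : ℝ | ENNReal.ofReal y < D i}.indicator
        fun y => (R : ℂ) * (k i lam y * f i y)) Finset.univ (Ioc 0 R) x = (R : ℂ) ^ n *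
      orderedProd A (fun i => {y : ℝ | ENNReal.ofReal y < D i}.indicator
        fun y => (k i lam y * f i y)) Finset.univ (Ioc 0 R) x := by
    intro x
    have := orderedProd_const_mul (A := A) (R : ℂ) (fun i => {y : ℝ | ENNReal.ofReal y < D i}.indicator
        fun y => (k i lam y * f i y)) (Ioc 0 R) x
    rw [Fintype.card_fin] at this
    rw [← this]
    congr 1
    funext i y
    by_cases h : y ∈ {y : ℝ | ENNReal.ofReal y < D i} <;> simp only [h, indicator_of_mem,
      indicator_of_notMem, not_false_eq_true, mul_zero]
  simp only [h1]
  unfold uniformIoc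
  rw [pi_smul_measure _ hc, integral_smul_measure, integral_const_mul, ← Measure.restrict_pi_pi,
    Fintype.card_fin, ENNReal.toReal_pow, ENNReal.toReal_inv, ENNReal.toReal_ofReal hR.le]
  have h2 : ∀ z : ℂ, (R⁻¹ ^ n : ℝ) • ((R : ℂ) ^ n * z) = z := by
    intro z
    have : (R : ℂ) ≠ 0 := by exact_mod_cast hR.ne'
    rw [Complex.real_smul]
    push_cast
    rw [← mul_assoc, ← mul_pow, inv_mul_cancel₀ this, one_pow, one_mul]
  rw [h2]
  have hm : MeasurableSet (univ.pi fun _ : Fin n => Ioc 0 R) :=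
    MeasurableSet.univ_pi fun _ => measurableSet_Ioc
  unfold multilinearOp
  have h3 : ∀ x ∈ univ.pi fun _ : Fin n => Ioc 0 R,
      multilinearIntegrand (truncKernel k D) A f lam x =
      orderedProd A (fun i => {y : ℝ | ENNReal.ofReal y < D i}.indicator
        fun y => k i lam y * f i y) Finset.univ (Ioc 0 R) x := fun x hx =>
    multilinearIntegrand_truncKernel_eq_orderedProd fun i => hx i (mem_univ i)
  rw [← volume_pi, ← setIntegral_congr_fun hm h3]
  refine setIntegral_eq_of_subset_of_forall_sdiff_eq_zero ?_ ?_ ?_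
  · have : posOrthant n = univ.pi fun _ : Fin n => Ioi (0 : ℝ) := by
      ext x; simp [posOrthant]
    rw [this]
    exact MeasurableSet.univ_pi fun _ => measurableSet_Ioi
  · intro x hx i
    exact (hx i (mem_univ i)).1
  · rintro x ⟨hx, hx'⟩
    simp only [mem_univ_pi, mem_Ioc, not_forall, not_and, not_le] at hx'
    obtain ⟨i, hi⟩ := hx'
    unfold multilinearIntegrand
    have : truncKernel k D i lam (x i) = 0 := by
      refine indicator_of_notMem ?_ _
      refine not_lt.2 ((hD i).trans (ENNReal.ofReal_le_ofReal (hi (hx i)).le))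
    rw [Finset.prod_eq_zero (Finset.mem_univ i) (by rw [this, zero_mul]), zero_mul]

/-! ### The dyadic sum controls all truncations -/

/-- Hölder's inequality against the constant function on a subset of `(0, R]`. -/
theorem setIntegral_norm_le_of_subset_Ioc {p q R : ℝ} (hpq : p.HolderConjugate q) (hR : 0 < R)
    {f : ℝ → ℂ} (hf : Measurable f) {J : Set ℝ} (hJR : J ⊆ Ioc 0 R)
    (hfi : IntegrableOn (fun x => ‖f x‖ ^ p) J) :
    ∫ x in J, ‖f x‖ ≤ R ^ (1 / q) * (∫ x in J, ‖f x‖ ^ p) ^ (1 / p) := by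
  have hp0 := hpq.pos
  have hq0 := hpq.symm.pos
  have hvol : volume J ≠ ∞ := ((measure_mono hJR).trans_lt measure_Ioc_lt_top).ne
  have : IsFiniteMeasure (volume.restrict J) := ⟨by
    rw [Measure.restrict_apply_univ]; exact hvol.lt_top⟩
  have hfm : MemLp f (ENNReal.ofReal p) (volume.restrict J) := by
    rw [← integrable_norm_rpow_iff hf.aestronglyMeasurable (by simpa using hp0)
      ENNReal.ofReal_ne_top, ENNReal.toReal_ofReal hp0.le]
    exact hfi
  have h := integral_mul_le_Lp_mul_Lq_of_nonneg (μ := volume.restrict J) hpq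
    (f := fun x => ‖f x‖) (g := fun _ => (1 : ℝ)) (ae_of_all _ fun _ => norm_nonneg _)
    (ae_of_all _ fun _ => zero_le_one) hfm.norm (memLp_const 1)
  simp only [mul_one, Real.one_rpow] at h
  refine h.trans ?_
  rw [mul_comm]
  refine mul_le_mul_of_nonneg_right ?_ (by positivity)
  refine Real.rpow_le_rpow (by positivity) ?_ (by positivity)
  rw [integral_const, smul_eq_mul, mul_one, measureReal_restrict_apply_univ, measureReal_def]
  refine ENNReal.toReal_le_of_le_ofReal hR.le ((measure_mono hJR).trans ?_)
  simp

theorem integrableOn_of_integrable_rpow {p R : ℝ} (hp : 1 ≤ p) {f : ℝ → ℂ} (hf : Measurable f)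
    (hfi : IntegrableOn (fun x => ‖f x‖ ^ p) (Ioi 0)) : IntegrableOn f (Ioc 0 R) := by
  have hfi' : IntegrableOn (fun x => 1 + ‖f x‖ ^ p) (Ioc 0 R) :=
    (integrableOn_const measure_Ioc_lt_top.ne).add (hfi.mono_set fun x hx => hx.1)
  refine hfi'.mono' hf.aestronglyMeasurable (ae_of_all _ fun x => ?_)
  rcases le_total ‖f x‖ 1 with h | h
  · have := Real.rpow_nonneg (norm_nonneg (f x)) p
    linarith
  · have := Real.self_le_rpow_of_one_le h hp
    linarith

/-- The weighted sum over the dyadic tree of the `q`-th powers of the increments. -/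
noncomputable def dyadicSum {n : ℕ} (q δ : ℝ) (U : ℝ → ℝ) (k : Fin n → ℝ → ℝ → ℂ)
    (f : Fin n → ℝ → ℂ) (lam : ℝ) : ℝ≥0∞ :=
  ∑' z : ℕ × ℕ, ENNReal.ofReal (2 ^ (δ * z.1) *
    ∑ i, ‖kernelOp (k i) ((dyadicIoc U z.1 z.2).indicator (f i)) lam‖ ^ q)

theorem measurable_dyadicSum {n : ℕ} (q δ : ℝ) (U : ℝ → ℝ) {k : Fin n → ℝ → ℝ → ℂ}
    (hk : ∀ i, Measurable (Function.uncurry (k i))) {f : Fin n → ℝ → ℂ}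
    (hf : ∀ i, Measurable (f i)) : Measurable (dyadicSum q δ U k f) := by
  unfold dyadicSum
  refine Measurable.tsum fun z => (Measurable.const_mul ?_ _).ennreal_ofReal
  exact Finset.measurable_sum _ fun i _ =>
    (measurable_kernelOp (hk i) ((hf i).indicator (measurableSet_dyadicIoc _ _ _))).norm.pow_const q

theorem dyadicIoc_eq_empty {U : ℝ → ℝ} {R : ℝ} (hU1 : ∀ t, 1 ≤ t → U t = R) {m j : ℕ}
    (hj : 2 ^ m ≤ j) : dyadicIoc U m j = ∅ := by
  have h1 : (1 : ℝ) ≤ (j : ℝ) / 2 ^ m := by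
    rw [le_div_iff₀ (by positivity), one_mul]
    exact_mod_cast hj
  have h2 : (1 : ℝ) ≤ ((j : ℝ) + 1) / 2 ^ m := h1.trans (by gcongr; linarith)
  rw [dyadicIoc, hU1 _ h1, hU1 _ h2, Ioc_self]

theorem dyadicIoc_width (m j : ℕ) :
    ((j : ℝ) + 1) / 2 ^ m - (j : ℝ) / 2 ^ m = (2 ^ m)⁻¹ := by
  rw [← sub_div, add_sub_cancel_left, one_div]

/-- Interpolation on each dyadic interval, summed by Tonelli's theorem: an interval of generation
`m` carries mass at most `(n + 1) / 2 ^ m`, and there are `2 ^ m` of them. -/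
theorem exists_lintegral_dyadicSum_le (n : ℕ) {p q δ : ℝ} (hpq : p.HolderConjugate q) (hq : 2 < q)
    (hδ : δ < q - 2) (B₀ B₂ : ℝ≥0) (hB : 0 < B₀) : ∃ C : ℝ≥0, ∀ (I : Set ℝ)
    (k : Fin n → ℝ → ℝ → ℂ) (f : Fin n → ℝ → ℂ) (R : ℝ) (U : ℝ → ℝ),
    (∀ i, Measurable (Function.uncurry (k i))) → (∀ i lam x, ‖k i lam x‖ ≤ B₀) →
    (∀ i, L2Bound I (k i) B₂) → (∀ i, Measurable (f i)) →
    (∀ i, IntegrableOn (fun x => ‖f i x‖ ^ p) (Ioi 0)) →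
    (∀ t, U t ∈ Icc 0 R) → (∀ t, 1 ≤ t → U t = R) →
    (∀ i s t, s ≤ t → ∫ x in Ioc (U s) (U t), ‖f i x‖ ^ p ≤ (n + 1) * (t - s)) →
    ∫⁻ lam in I, dyadicSum q δ U k f lam ≤ C := by
  obtain ⟨CM, hCM⟩ := lintegral_kernelOp_rpow_le hpq hq B₀ B₂ hB
  set r : ℝ := 2 ^ (δ - (q - 2)) with hr
  have hr0 : 0 ≤ r := by positivity
  have hr1 : r < 1 := Real.rpow_lt_one_of_one_lt_of_neg one_lt_two (by linarith)
  set K : ℝ≥0∞ := n * CM * ENNReal.ofReal (((n : ℝ) + 1) ^ (q - 1)) with hK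
  have hKtop : K ≠ ∞ := by
    rw [hK]
    exact ENNReal.mul_ne_top (ENNReal.mul_ne_top (ENNReal.natCast_ne_top n) ENNReal.coe_ne_top)
      ENNReal.ofReal_ne_top
  have hKr : K * (1 - ENNReal.ofReal r)⁻¹ ≠ ∞ := by
    refine ENNReal.mul_ne_top hKtop (ENNReal.inv_ne_top.2 ?_)
    rw [ne_eq, tsub_eq_zero_iff_le, not_le, ENNReal.ofReal_lt_one]
    exact hr1
  refine ⟨(K * (1 - ENNReal.ofReal r)⁻¹).toNNReal, ?_⟩
  rw [ENNReal.coe_toNNReal hKr]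
  intro I k f R U hk hkB hL2 hf hfi hUR hU1 hUf
  have hJR : ∀ m j, dyadicIoc U m j ⊆ Ioc 0 R := fun m j =>
    Ioc_subset_Ioc (hUR _).1 (hUR _).2
  have hq0 : 0 < q := by linarith
  have hp0 := hpq.pos
  have hJm := measurableSet_dyadicIoc U
  have hind : ∀ i m j, (fun x => ‖(dyadicIoc U m j).indicator (f i) x‖ ^ p) =
      (dyadicIoc U m j).indicator fun x => ‖f i x‖ ^ p := by
    intro i m j
    funext x
    by_cases h : x ∈ dyadicIoc U m j
    · rw [indicator_of_mem h, indicator_of_mem h]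
    · rw [indicator_of_notMem h, indicator_of_notMem h, norm_zero, Real.zero_rpow hp0.ne']
  have hterm : ∀ i m j, ∫⁻ lam in I,
      ENNReal.ofReal (‖kernelOp (k i) ((dyadicIoc U m j).indicator (f i)) lam‖ ^ q) ≤
      CM * ENNReal.ofReal ((((n : ℝ) + 1) * (2 ^ m)⁻¹) ^ (q - 1)) := by
    intro i m j
    have h1 := hCM I (k i) (hk i) (hkB i) (hL2 i) ((dyadicIoc U m j).indicator (f i)) R
      ((hf i).indicator (hJm m j))
      (fun x hx => indicator_of_notMem (fun h => hx (hJR m j h)) _)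
      (by rw [hind]; exact (hfi i).indicator (hJm m j))
    have h2 : ∫ x in Ioi 0, ‖(dyadicIoc U m j).indicator (f i) x‖ ^ p =
        ∫ x in dyadicIoc U m j, ‖f i x‖ ^ p := by
      rw [hind, setIntegral_indicator (hJm m j),
        inter_eq_right.2 ((hJR m j).trans Ioc_subset_Ioi_self)]
    rw [h2] at h1
    have h3 : ∫ x in dyadicIoc U m j, ‖f i x‖ ^ p ≤ ((n : ℝ) + 1) * (2 ^ m)⁻¹ := by
      have := hUf i ((j : ℝ) / 2 ^ m) (((j : ℝ) + 1) / 2 ^ m) (by gcongr; linarith)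
      rwa [dyadicIoc_width] at this
    calc _ = ∫⁻ lam in I, ‖kernelOp (k i) ((dyadicIoc U m j).indicator (f i)) lam‖ₑ ^ q := by
          refine lintegral_congr fun lam => ?_
          rw [← ofReal_norm, ENNReal.ofReal_rpow_of_nonneg (norm_nonneg _) hq0.le]
      _ ≤ _ := h1
      _ ≤ _ := by
          gcongr
          linarith
  have hzero : ∀ m j, 2 ^ m ≤ j → ∀ i lam,
      kernelOp (k i) ((dyadicIoc U m j).indicator (f i)) lam = 0 := by
    intro m j hj i lam
    rw [dyadicIoc_eq_empty hU1 hj]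
    simp [kernelOp]
  have hmeas : ∀ i m j, Measurable fun lam =>
      ENNReal.ofReal (‖kernelOp (k i) ((dyadicIoc U m j).indicator (f i)) lam‖ ^ q) := fun i m j =>
    ((measurable_kernelOp (hk i) ((hf i).indicator (hJm m j))).norm.pow_const q).ennreal_ofReal
  have hexp : ∀ z : ℕ × ℕ, ∀ lam, ENNReal.ofReal (2 ^ (δ * z.1) *
      ∑ i, ‖kernelOp (k i) ((dyadicIoc U z.1 z.2).indicator (f i)) lam‖ ^ q) =
      ENNReal.ofReal (2 ^ (δ * z.1)) * ∑ i,
        ENNReal.ofReal (‖kernelOp (k i) ((dyadicIoc U z.1 z.2).indicator (f i)) lam‖ ^ q) := by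
    intro z lam
    rw [ENNReal.ofReal_mul (by positivity), ENNReal.ofReal_sum_of_nonneg]
    intro i _
    positivity
  have hnode : ∀ m j : ℕ, ∫⁻ lam in I, ENNReal.ofReal (2 ^ (δ * m) *
      ∑ i, ‖kernelOp (k i) ((dyadicIoc U m j).indicator (f i)) lam‖ ^ q) ≤
      if j < 2 ^ m then ENNReal.ofReal (2 ^ (δ * m)) * (n * (CM *
        ENNReal.ofReal ((((n : ℝ) + 1) * (2 ^ m)⁻¹) ^ (q - 1)))) else 0 := by
    intro m j
    split_ifs with hj
    · simp only [hexp (m, j)]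
      rw [lintegral_const_mul _ (Finset.measurable_sum _ fun i _ => hmeas i m j),
        lintegral_finsetSum _ fun i _ => hmeas i m j]
      gcongr
      refine (Finset.sum_le_sum fun i _ => hterm i m j).trans ?_
      simp
    · simp only [hzero m j (not_lt.1 hj), norm_zero, Real.zero_rpow hq0.ne']
      simp
  have hlev : ∀ m : ℕ, ∑' j : ℕ, (if j < 2 ^ m then ENNReal.ofReal (2 ^ (δ * m)) * (n * (CM *
      ENNReal.ofReal ((((n : ℝ) + 1) * (2 ^ m)⁻¹) ^ (q - 1)))) else 0) =
      K * ENNReal.ofReal r ^ m := by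
    intro m
    rw [tsum_eq_sum (s := Finset.range (2 ^ m)) fun j hj => by
      rw [if_neg (by simpa using hj)]]
    rw [Finset.sum_congr rfl fun j hj => if_pos (Finset.mem_range.1 hj), Finset.sum_const,
      Finset.card_range, nsmul_eq_mul, hK, ← ENNReal.ofReal_pow hr0,
      Real.mul_rpow (by positivity) (by positivity), ENNReal.ofReal_mul (by positivity)]
    have e1 : (((2 ^ m : ℕ) : ℝ≥0∞)) = ENNReal.ofReal (2 ^ m) := by
      rw [ENNReal.ofReal_pow zero_le_two]; simp
    have e2 : r ^ m = 2 ^ m * 2 ^ (δ * m) * (((2 : ℝ) ^ m)⁻¹) ^ (q - 1) := by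
      rw [← Real.rpow_natCast 2 m, ← Real.rpow_neg zero_le_two, ← Real.rpow_mul zero_le_two,
        ← Real.rpow_add two_pos, ← Real.rpow_add two_pos, hr, ← Real.rpow_natCast,
        ← Real.rpow_mul zero_le_two]
      congr 1
      ring
    rw [e2, ENNReal.ofReal_mul (by positivity), ENNReal.ofReal_mul (by positivity), e1]
    ring
  have hzm : ∀ z : ℕ × ℕ, Measurable fun lam => ENNReal.ofReal (2 ^ (δ * z.1) *
      ∑ i, ‖kernelOp (k i) ((dyadicIoc U z.1 z.2).indicator (f i)) lam‖ ^ q) := by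
    intro z
    refine (Measurable.const_mul ?_ _).ennreal_ofReal
    exact Finset.measurable_sum _ fun i _ =>
      (measurable_kernelOp (hk i) ((hf i).indicator (hJm _ _))).norm.pow_const q
  unfold dyadicSum
  rw [lintegral_tsum fun z => (hzm z).aemeasurable, ENNReal.tsum_prod', ← ENNReal.tsum_geometric,
    ← ENNReal.tsum_mul_left]
  refine ENNReal.tsum_le_tsum fun m => ?_
  rw [← hlev m]
  exact ENNReal.tsum_le_tsum fun j => hnode m j

/-- Pointwise control of all truncations by a power of the dyadic sum. -/
theorem exists_multilinearOp_le_dyadicSum (n : ℕ) (hn : 1 ≤ n) {p q δ : ℝ}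
    (hpq : p.HolderConjugate q) (hq : 2 < q) (hδ : q / 2 - 1 < δ) : ∃ C : ℝ≥0, ∀
    (B₀ : ℝ≥0) (k : Fin n → ℝ → ℝ → ℂ) (A : Finset (Fin n × Fin n)) (f : Fin n → ℝ → ℂ) (R : ℝ)
    (U : ℝ → ℝ), 0 < R →
    (∀ i, Measurable (Function.uncurry (k i))) → (∀ i lam x, ‖k i lam x‖ ≤ B₀) →
    (∀ i, Measurable (f i)) →
    (∀ i, IntegrableOn (fun x => ‖f i x‖ ^ p) (Ioi 0)) →
    Monotone U → (∀ t, U t ∈ Icc 0 R) → U 0 = 0 → (∀ t, 1 ≤ t → U t = R) →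
    (∀ i s t, s ≤ t → ∫ x in Ioc (U s) (U t), ‖f i x‖ ^ p ≤ (n + 1) * (t - s)) →
    ∀ lam, dyadicSum q δ U k f lam ≠ ∞ → ∀ D : Fin n → ℝ≥0∞, (∀ i, D i ≤ ENNReal.ofReal R) →
    ‖multilinearOp (truncKernel k D) A f lam‖ₑ ≤ C * dyadicSum q δ U k f lam ^ (n / q) := by
  have : Nonempty (Fin n) := ⟨⟨0, hn⟩⟩
  have hq0 : 0 < q := by linarith
  have hp0 := hpq.pos
  set θ : ℝ := 2 ^ ((q / 2 - 1 - δ) / q) with hθ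
  have hθ1 : θ < 1 := Real.rpow_lt_one_of_one_lt_of_neg one_lt_two
    (div_neg_of_neg_of_pos (by linarith) hq0)
  obtain ⟨C, hC0, hC⟩ := exists_orderedProd_bound (Fin n) (θ := θ) (by positivity) hθ1
  refine ⟨C.toNNReal, ?_⟩
  intro B₀ k A f R U hR hk hkB hf hfi hU hUR hU0 hU1 hUf lam hfin D hD
  have := isProbabilityMeasure_uniformIoc hR
  have hJR : ∀ m j, dyadicIoc U m j ⊆ Ioc 0 R := fun m j =>
    Ioc_subset_Ioc (hUR _).1 (hUR _).2
  have hJm := measurableSet_dyadicIoc U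
  have hJ0 : dyadicIoc U 0 0 = Ioc 0 R := by
    simp [dyadicIoc, hU0, hU1 1 le_rfl]
  have hkm : ∀ i, Measurable (k i lam) := fun i => (hk i).comp measurable_prodMk_left
  have hfR : ∀ i, IntegrableOn (f i) (Ioc 0 R) := fun i =>
    integrableOn_of_integrable_rpow hpq.lt.le (hf i) (hfi i)
  have hkf : ∀ i, IntegrableOn (fun x => k i lam x * f i x) (Ioc 0 R) := fun i =>
    (hfR i).bdd_mul (hkm i).aestronglyMeasurable (ae_of_all _ (hkB i lam))
  set G : Fin n → ℝ → ℂ := fun i x => (R : ℂ) * (k i lam x * f i x) with hG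
  have hcR : (ENNReal.ofReal R)⁻¹ ≠ ∞ := ENNReal.inv_ne_top.2 (by simpa using hR)
  have hGi : ∀ i, Integrable (G i) (uniformIoc R) := fun i =>
    ((hkf i).const_mul _).smul_measure hcR
  set α : ℕ → ℕ → ℝ := fun m j =>
    ∑ i, ‖kernelOp (k i) ((dyadicIoc U m j).indicator (f i)) lam‖ ^ q with hα
  have hα0 : ∀ m j, 0 ≤ α m j := fun m j => Finset.sum_nonneg fun i _ => by positivity
  have hω0 : ∀ z : ℕ × ℕ, 0 ≤ (2 : ℝ) ^ (δ * z.1) * α z.1 z.2 := fun z =>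
    mul_nonneg (by positivity) (hα0 _ _)
  have hsum : Summable fun z : ℕ × ℕ => (2 : ℝ) ^ (δ * z.1) * α z.1 z.2 := by
    have := ENNReal.summable_toReal hfin
    refine this.congr fun z => ?_
    rw [ENNReal.toReal_ofReal (hω0 z)]
  have hW : dyadicSum q δ U k f lam =
      ENNReal.ofReal (∑' z : ℕ × ℕ, (2 : ℝ) ^ (δ * z.1) * α z.1 z.2) :=
    (ENNReal.ofReal_tsum_of_nonneg hω0 hsum).symm
  obtain ⟨b, hb0, hb2, hbα, hb00⟩ := exists_dyadic_majorant hq hα0 hsum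
  set w : ℝ := ∑' z : ℕ × ℕ, (2 : ℝ) ^ (δ * z.1) * α z.1 z.2 with hw
  have hw0 : 0 ≤ w := tsum_nonneg hω0
  have hset : ∀ i m j, ∫ x in dyadicIoc U m j, G i x ∂(uniformIoc R) =
      kernelOp (k i) ((dyadicIoc U m j).indicator (f i)) lam := by
    intro i m j
    rw [setIntegral_uniformIoc hR (hJm m j) (hJR m j), hG, integral_const_mul,
      Complex.real_smul, ← mul_assoc, Complex.ofReal_inv,
      inv_mul_cancel₀ (by exact_mod_cast hR.ne'), one_mul]
    have e : ∀ x, k i lam x * (dyadicIoc U m j).indicator (f i) x =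
        (dyadicIoc U m j).indicator (fun x => k i lam x * f i x) x := fun x => by
      by_cases h : x ∈ dyadicIoc U m j <;> simp [h]
    unfold kernelOp
    simp only [e]
    rw [setIntegral_indicator (hJm m j), inter_eq_right.2 ((hJR m j).trans Ioc_subset_Ioi_self)]
  have hbound := hC (uniformIoc R) A G D U b (B₀ * (R ^ (1 / q) * ((n : ℝ) + 1) ^ (1 / p)))
    (2 ^ (-(1 / p))) (fun i => ((hkm i).mul (hf i)).const_mul _) hGi hU hb0 hb2
    (fun i m j => by
      rw [hset]
      refine (Real.rpow_le_rpow_iff (norm_nonneg _) (hb0 m j) hq0).1 (le_trans ?_ (hbα m j))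
      exact Finset.single_le_sum
        (f := fun i => ‖kernelOp (k i) ((dyadicIoc U m j).indicator (f i)) lam‖ ^ q)
        (fun i _ => by positivity) (Finset.mem_univ i))
    (by positivity) (by positivity)
    (by
      have hp2 : p < 2 := by
        have := hpq.mul_eq_add
        nlinarith [hpq.lt]
      rw [← Real.rpow_natCast, ← Real.rpow_mul zero_le_two]
      have e : (2 : ℝ) * 2 ^ (-(1 / p) * ((2 : ℕ) : ℝ)) = 2 ^ (1 + -(1 / p) * ((2 : ℕ) : ℝ)) := by
        rw [Real.rpow_add two_pos, Real.rpow_one]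
      rw [e]
      refine Real.rpow_lt_one_of_one_lt_of_neg one_lt_two ?_
      have : 1 < 1 / p * 2 := by
        rw [div_mul_eq_mul_div, one_mul, lt_div_iff₀ hp0]
        linarith
      push_cast
      linarith)
    (fun i m j => by
      have h3 : ∫ x in dyadicIoc U m j, ‖f i x‖ ^ p ≤ ((n : ℝ) + 1) * (2 ^ m)⁻¹ := by
        have := hUf i ((j : ℝ) / 2 ^ m) (((j : ℝ) + 1) / 2 ^ m) (by gcongr; linarith)
        rwa [dyadicIoc_width] at this
      have h4 := setIntegral_norm_le_of_subset_Ioc hpq hR (hf i) (hJR m j)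
        ((hfi i).mono_set ((hJR m j).trans Ioc_subset_Ioi_self))
      rw [setIntegral_uniformIoc hR (hJm m j) (hJR m j), smul_eq_mul]
      have h5 : ∀ x, ‖G i x‖ = R * ‖k i lam x * f i x‖ := fun x => by
        rw [hG, norm_mul, Complex.norm_real, Real.norm_of_nonneg hR.le]
      simp only [h5]
      rw [integral_const_mul, ← mul_assoc, inv_mul_cancel₀ hR.ne', one_mul]
      have h6 : ((2 : ℝ) ^ (-(1 / p))) ^ m = ((2 ^ m)⁻¹) ^ (1 / p) := by
        rw [← Real.rpow_natCast, ← Real.rpow_mul zero_le_two, ← Real.rpow_natCast 2 m,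
          ← Real.rpow_neg zero_le_two, ← Real.rpow_mul zero_le_two]
        congr 1
        ring
      calc ∫ x in dyadicIoc U m j, ‖k i lam x * f i x‖
          ≤ ∫ x in dyadicIoc U m j, B₀ * ‖f i x‖ := by
            refine setIntegral_mono ((hkf i).mono_set (hJR m j)).norm
              (((hfR i).mono_set (hJR m j)).norm.const_mul _) fun x => ?_
            simp only [norm_mul]
            exact mul_le_mul_of_nonneg_right (hkB i lam x) (norm_nonneg _)
        _ = B₀ * ∫ x in dyadicIoc U m j, ‖f i x‖ := integral_const_mul _ _
        _ ≤ B₀ * (R ^ (1 / q) * (((n : ℝ) + 1) * (2 ^ m)⁻¹) ^ (1 / p)) := by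
            refine mul_le_mul_of_nonneg_left (h4.trans ?_) B₀.2
            refine mul_le_mul_of_nonneg_left ?_ (by positivity)
            exact Real.rpow_le_rpow (integral_nonneg fun x => by positivity) h3 (by positivity)
        _ = _ := by
            rw [h6, Real.mul_rpow (by positivity) (by positivity)]
            ring)
  rw [Fintype.card_fin, hJ0] at hbound
  rw [multilinearOp_truncKernel_eq hR hD, hW, ENNReal.ofReal_rpow_of_nonneg hw0 (by positivity),
    ENNReal.ofNNReal_toNNReal, ← ENNReal.ofReal_mul hC0, ← ofReal_norm]
  refine ENNReal.ofReal_le_ofReal (hbound.trans (mul_le_mul_of_nonneg_left ?_ hC0))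
  calc b 0 0 ^ n = (b 0 0 ^ q) ^ ((n : ℝ) / q) := by
        rw [← Real.rpow_mul (hb0 0 0), mul_div_cancel₀ _ hq0.ne', Real.rpow_natCast]
    _ ≤ w ^ ((n : ℝ) / q) := Real.rpow_le_rpow (Real.rpow_nonneg (hb0 0 0) _) hb00 (by positivity)

/-! ### The maximal operator -/

section Maximal
variable {n : ℕ} {k : Fin n → ℝ → ℝ → ℂ} {A : Finset (Fin n × Fin n)} {f : Fin n → ℝ → ℂ}

theorem restrict_posOrthant (n : ℕ) : (volume : Measure (Fin n → ℝ)).restrict (posOrthant n) =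
    Measure.pi fun _ => volume.restrict (Ioi (0 : ℝ)) := by
  have : posOrthant n = univ.pi fun _ : Fin n => Ioi (0 : ℝ) := by
    ext x; simp [posOrthant]
  rw [this, volume_pi, Measure.restrict_pi_pi]

theorem measurable_multilinearIntegrand (hk : ∀ i, Measurable (Function.uncurry (k i)))
    (hf : ∀ i, Measurable (f i)) (D : Fin n → ℝ≥0∞) :
    Measurable (Function.uncurry (multilinearIntegrand (truncKernel k D) A f)) := by
  have hx : ∀ j, Measurable fun z : ℝ × (Fin n → ℝ) => z.2 j := fun j =>
    (measurable_pi_apply j).comp measurable_snd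
  unfold multilinearIntegrand truncKernel
  refine Measurable.mul (Finset.measurable_prod _ fun j _ => Measurable.mul ?_
    ((hf j).comp (hx j))) (Finset.measurable_prod _ fun α _ => ?_)
  · have h1 : Measurable fun z : ℝ × (Fin n → ℝ) => k j z.1 (z.2 j) :=
      (hk j).comp (measurable_fst.prodMk (hx j))
    exact h1.indicator (s := {z | ENNReal.ofReal (z.2 j) < D j})
      (measurableSet_lt (hx j).ennreal_ofReal measurable_const)
  · exact (measurable_const.indicator measurableSet_Ioi).comp ((hx α.1).sub (hx α.2))

theorem measurable_multilinearOp (hk : ∀ i, Measurable (Function.uncurry (k i)))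
    (hf : ∀ i, Measurable (f i)) (D : Fin n → ℝ≥0∞) :
    Measurable (multilinearOp (truncKernel k D) A f) :=
  ((measurable_multilinearIntegrand hk hf D).stronglyMeasurable.integral_prod_right
    (ν := volume.restrict (posOrthant n))).measurable

theorem norm_multilinearIntegrand_le {B₀ : ℝ≥0} (hkB : ∀ i lam x, ‖k i lam x‖ ≤ B₀)
    (D : Fin n → ℝ≥0∞) (lam : ℝ) (x : Fin n → ℝ) :
    ‖multilinearIntegrand (truncKernel k D) A f lam x‖ ≤
      ∏ i, (fun y => B₀ * ‖{y : ℝ | ENNReal.ofReal y < D i}.indicator (f i) y‖) (x i) := by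
  unfold multilinearIntegrand truncKernel
  rw [norm_mul, norm_prod, norm_prod]
  refine (mul_le_of_le_one_right (Finset.prod_nonneg fun _ _ => norm_nonneg _) ?_).trans ?_
  · refine Finset.prod_le_one (fun _ _ => norm_nonneg _) fun α _ => ?_
    by_cases h : x α.1 - x α.2 ∈ Ioi (0 : ℝ)
    · rw [indicator_of_mem h, norm_one]
    · rw [indicator_of_notMem h, norm_zero]; exact zero_le_one
  · refine Finset.prod_le_prod (fun _ _ => norm_nonneg _) fun i _ => ?_
    rw [norm_mul]
    beta_reduce
    by_cases h : x i ∈ {y : ℝ | ENNReal.ofReal y < D i}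
    · rw [indicator_of_mem h, indicator_of_mem h]
      exact mul_le_mul_of_nonneg_right (hkB _ _ _) (norm_nonneg _)
    · rw [indicator_of_notMem h, indicator_of_notMem h]
      simp

theorem integrable_prod_majorant {B₀ : ℝ≥0} {D : Fin n → ℝ≥0∞}
    (hfD : ∀ i, IntegrableOn ({y : ℝ | ENNReal.ofReal y < D i}.indicator (f i)) (Ioi 0)) :
    Integrable (fun x : Fin n → ℝ =>
      ∏ i, (fun y => (B₀ : ℝ) * ‖{y : ℝ | ENNReal.ofReal y < D i}.indicator (f i) y‖) (x i))
      (volume.restrict (posOrthant n)) := by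
  rw [restrict_posOrthant]
  exact Integrable.fintype_prod (f := fun i y =>
    (B₀ : ℝ) * ‖{y : ℝ | ENNReal.ofReal y < D i}.indicator (f i) y‖) fun i => (hfD i).norm.const_mul _

theorem integrableOn_multilinearIntegrand {B₀ : ℝ≥0}
    (hk : ∀ i, Measurable (Function.uncurry (k i))) (hkB : ∀ i lam x, ‖k i lam x‖ ≤ B₀)
    (hf : ∀ i, Measurable (f i)) {D : Fin n → ℝ≥0∞}
    (hfD : ∀ i, IntegrableOn ({y : ℝ | ENNReal.ofReal y < D i}.indicator (f i)) (Ioi 0))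
    (lam : ℝ) :
    IntegrableOn (multilinearIntegrand (truncKernel k D) A f lam) (posOrthant n) :=
  (integrable_prod_majorant hfD).mono'
    ((measurable_multilinearIntegrand hk hf D).comp measurable_prodMk_left).aestronglyMeasurable
    (ae_of_all _ (norm_multilinearIntegrand_le hkB D lam))

/-- The bound for integrable functions, which is the endpoint `p = 1`. -/
theorem norm_multilinearOp_le {B₀ : ℝ≥0} (hkB : ∀ i lam x, ‖k i lam x‖ ≤ B₀)
    (hf : ∀ i, IntegrableOn (f i) (Ioi 0)) (D : Fin n → ℝ≥0∞) (lam : ℝ) :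
    ‖multilinearOp (truncKernel k D) A f lam‖ ≤ ∏ i, (B₀ * ∫ x in Ioi 0, ‖f i x‖) := by
  have hDm : ∀ i, MeasurableSet {y : ℝ | ENNReal.ofReal y < D i} := fun i =>
    measurableSet_lt ENNReal.measurable_ofReal measurable_const
  have hfD : ∀ i, IntegrableOn ({y : ℝ | ENNReal.ofReal y < D i}.indicator (f i)) (Ioi 0) :=
    fun i => (hf i).indicator (hDm i)
  refine (norm_integral_le_of_norm_le (integrable_prod_majorant hfD)
    (ae_of_all _ (norm_multilinearIntegrand_le hkB D lam))).trans ?_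
  rw [restrict_posOrthant, integral_fintype_prod_eq_prod (fun i y =>
    (B₀ : ℝ) * ‖{y : ℝ | ENNReal.ofReal y < D i}.indicator (f i) y‖)]
  refine Finset.prod_le_prod (fun i _ => integral_nonneg fun x => by positivity) fun i _ => ?_
  rw [integral_const_mul]
  refine mul_le_mul_of_nonneg_left ?_ B₀.2
  exact integral_mono (hfD i).norm (hf i).norm fun x => norm_indicator_le_norm_self _ _

/-- Truncations are continuous from below, since they are strict inequalities `x < D`. -/
theorem tendsto_multilinearOp_truncKernel {lam : ℝ} {D : Fin n → ℝ≥0∞}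
    (hk : ∀ i, Measurable (Function.uncurry (k i))) (hf : ∀ i, Measurable (f i))
    (hint : IntegrableOn (multilinearIntegrand (truncKernel k D) A f lam) (posOrthant n))
    {u : ℕ → Fin n → ℝ≥0∞} (hu : ∀ N i, u N i ≤ D i)
    (hlim : ∀ i, Filter.Tendsto (fun N => u N i) Filter.atTop (nhds (D i))) :
    Filter.Tendsto (fun N => multilinearOp (truncKernel k (u N)) A f lam) Filter.atTop
      (nhds (multilinearOp (truncKernel k D) A f lam)) := by
  refine tendsto_integral_of_dominated_convergence
    (fun x => ‖multilinearIntegrand (truncKernel k D) A f lam x‖) (fun N =>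
      ((measurable_multilinearIntegrand hk hf (u N)).comp
        measurable_prodMk_left).aestronglyMeasurable) hint.norm (fun N => ae_of_all _ fun x => ?_)
    (ae_of_all _ fun x => ?_)
  · unfold multilinearIntegrand
    rw [norm_mul, norm_mul, norm_prod Finset.univ, norm_prod Finset.univ]
    refine mul_le_mul_of_nonneg_right ?_ (norm_nonneg _)
    refine Finset.prod_le_prod (fun _ _ => norm_nonneg _) fun i _ => ?_
    rw [norm_mul, norm_mul]
    refine mul_le_mul_of_nonneg_right ?_ (norm_nonneg _)
    exact norm_indicator_le_of_subset (fun y hy => lt_of_lt_of_le hy (hu N i)) _ _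
  · refine tendsto_const_nhds.congr' ?_
    have : ∀ i, ∀ᶠ N in Filter.atTop,
        truncKernel k (u N) i lam (x i) = truncKernel k D i lam (x i) := by
      intro i
      by_cases h : ENNReal.ofReal (x i) < D i
      · filter_upwards [(hlim i).eventually (lt_mem_nhds h)] with N hN
        unfold truncKernel
        rw [indicator_of_mem (show x i ∈ {x : ℝ | ENNReal.ofReal x < D i} from h),
          indicator_of_mem (show x i ∈ {x : ℝ | ENNReal.ofReal x < u N i} from hN)]
      · refine Filter.Eventually.of_forall fun N => ?_
        unfold truncKernel
        rw [indicator_of_notMem (show x i ∉ {x : ℝ | ENNReal.ofReal x < D i} from h),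
          indicator_of_notMem (show x i ∉ {x : ℝ | ENNReal.ofReal x < u N i} from
            fun h' => h (lt_of_lt_of_le h' (hu N i)))]
    filter_upwards [Filter.eventually_all.2 this] with N hN
    unfold multilinearIntegrand
    simp only [hN]

/-- The supremum of the truncations at points of `S` bounded by `N`. -/
noncomputable def boundedMaximalOp (S : Set ℝ≥0∞) (N : ℕ) (k : Fin n → ℝ → ℝ → ℂ)
    (A : Finset (Fin n × Fin n)) (f : Fin n → ℝ → ℂ) (lam : ℝ) : ℝ≥0∞ :=
  ⨆ (D : Fin n → S) (_ : ∀ i, 0 < (D i : ℝ≥0∞) ∧ (D i : ℝ≥0∞) ≤ N),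
    ‖multilinearOp (truncKernel k fun i => (D i : ℝ≥0∞)) A f lam‖ₑ

theorem monotone_boundedMaximalOp (S : Set ℝ≥0∞) :
    Monotone fun N => boundedMaximalOp S N k A f := by
  intro N M hNM lam
  refine iSup_mono fun D => iSup_mono' fun h => ⟨fun i => ⟨(h i).1, (h i).2.trans ?_⟩, le_rfl⟩
  exact_mod_cast hNM

theorem measurable_boundedMaximalOp {S : Set ℝ≥0∞} (hS : S.Countable) (N : ℕ)
    (hk : ∀ i, Measurable (Function.uncurry (k i))) (hf : ∀ i, Measurable (f i)) :
    Measurable (boundedMaximalOp S N k A f) := by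
  have : Countable S := hS.to_subtype
  refine Measurable.iSup fun D => Measurable.iSup_Prop _ ?_
  exact (measurable_multilinearOp hk hf _).enorm

/-- By dominated convergence, countably many finite truncations suffice. A non-integrable truncation
has integral `0` by convention and can be ignored. -/
theorem maximalOp_eq_iSup_boundedMaximalOp {S : Set ℝ≥0∞} (hS : Dense S)
    (hk : ∀ i, Measurable (Function.uncurry (k i))) (hf : ∀ i, Measurable (f i)) (lam : ℝ) :
    maximalOp k A f lam = ⨆ N, boundedMaximalOp S N k A f lam := by
  refine le_antisymm (iSup₂_le fun D hD => ?_) (iSup_le fun N => iSup₂_le fun D hD => ?_)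
  · by_cases hint : IntegrableOn (multilinearIntegrand (truncKernel k D) A f lam) (posOrthant n)
    · have hseq := fun i => hS.exists_seq_strictMono_tendsto_of_lt (hD i)
      choose u _ hu hlim using hseq
      have h := (tendsto_multilinearOp_truncKernel hk hf hint (u := fun N i => u i N)
        (fun N i => (hu i N).1.2.le) hlim).enorm
      refine le_of_tendsto' h fun N => ?_
      have hfin : ∀ i, u i N ≠ ∞ := fun i => ((hu i N).1.2.trans_le le_top).ne
      choose M hM using fun i => ENNReal.exists_nat_gt (hfin i)
      refine le_iSup_of_le (Finset.univ.sup M) ?_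
      refine le_iSup₂_of_le (fun i => ⟨u i N, (hu i N).2⟩) (fun i => ⟨(hu i N).1.1, ?_⟩) le_rfl
      refine (hM i).le.trans ?_
      exact_mod_cast Finset.le_sup (f := M) (Finset.mem_univ i)
    · unfold multilinearOp
      rw [integral_undef hint, enorm_zero]
      exact zero_le
  · exact le_iSup₂_of_le (fun i => (D i : ℝ≥0∞)) (fun i => (hD i).1) le_rfl

theorem measurable_maximalOp (hk : ∀ i, Measurable (Function.uncurry (k i)))
    (hf : ∀ i, Measurable (f i)) : Measurable (maximalOp k A f) := by
  obtain ⟨S, hS, hSd⟩ := TopologicalSpace.exists_countable_dense ℝ≥0∞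
  have : maximalOp k A f = fun lam => ⨆ N, boundedMaximalOp S N k A f lam :=
    funext fun lam => maximalOp_eq_iSup_boundedMaximalOp hSd hk hf lam
  rw [this]
  exact Measurable.iSup fun N => measurable_boundedMaximalOp hS N hk hf

theorem multilinearIntegrand_congr_ae {k' : Fin n → ℝ → ℝ → ℂ} {f' : Fin n → ℝ → ℂ} {lam : ℝ}
    (hk : ∀ i, k i lam =ᵐ[volume.restrict (Ioi 0)] k' i lam)
    (hf : ∀ i, f i =ᵐ[volume.restrict (Ioi 0)] f' i) (D : Fin n → ℝ≥0∞) :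
    multilinearIntegrand (truncKernel k D) A f lam =ᵐ[volume.restrict (posOrthant n)]
      multilinearIntegrand (truncKernel k' D) A f' lam := by
  rw [restrict_posOrthant]
  have h1 : ∀ i, ∀ᵐ x ∂(Measure.pi fun _ : Fin n => volume.restrict (Ioi (0 : ℝ))),
      k i lam (x i) = k' i lam (x i) ∧ f i (x i) = f' i (x i) := fun i =>
    (Measure.tendsto_eval_ae_ae (μ := fun _ : Fin n => volume.restrict (Ioi (0 : ℝ)))
      (i := i)).eventually ((hk i).and (hf i))
  filter_upwards [ae_all_iff.2 h1] with x hx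
  unfold multilinearIntegrand truncKernel
  congr 1
  refine Finset.prod_congr rfl fun i _ => ?_
  rw [(hx i).2]
  congr 1
  by_cases h : x i ∈ {x : ℝ | ENNReal.ofReal x < D i}
  · rw [indicator_of_mem h, indicator_of_mem h, (hx i).1]
  · rw [indicator_of_notMem h, indicator_of_notMem h]

theorem maximalOp_congr_ae {k' : Fin n → ℝ → ℝ → ℂ} {f' : Fin n → ℝ → ℂ} {lam : ℝ}
    (hk : ∀ i, k i lam =ᵐ[volume.restrict (Ioi 0)] k' i lam)
    (hf : ∀ i, f i =ᵐ[volume.restrict (Ioi 0)] f' i) :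
    maximalOp k A f lam = maximalOp k' A f' lam := by
  unfold maximalOp multilinearOp
  refine iSup_congr fun D => iSup_congr fun _ => ?_
  rw [integral_congr_ae (multilinearIntegrand_congr_ae hk hf D)]

theorem maximalOp_const_mul (c : Fin n → ℂ) (lam : ℝ) :
    maximalOp k A (fun i x => c i * f i x) lam = (∏ i, ‖c i‖ₑ) * maximalOp k A f lam := by
  have h : ∀ (k : Fin n → ℝ → ℝ → ℂ), multilinearOp k A (fun i x => c i * f i x) lam =
      (∏ i, c i) * multilinearOp k A f lam := by
    intro k
    unfold multilinearOp
    rw [← integral_const_mul]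
    congr 1
    funext x
    unfold multilinearIntegrand
    rw [← mul_assoc, ← Finset.prod_mul_distrib]
    congr 1
    exact Finset.prod_congr rfl fun i _ => by ring
  unfold maximalOp
  have he : ‖∏ i, c i‖ₑ = ∏ i, ‖c i‖ₑ := by
    simp only [← ofReal_norm, norm_prod]
    rw [ENNReal.ofReal_prod_of_nonneg fun _ _ => norm_nonneg _]
  simp only [h, enorm_mul, he, ENNReal.mul_iSup]

end Maximal

/-- The maximal inequality for normalized functions and everywhere defined data. -/
theorem exists_lintegral_maximalOp_rpow_le (n : ℕ) (hn : 1 ≤ n) {p q : ℝ}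
    (hpq : p.HolderConjugate q) (hq : 2 < q) (B₀ B₂ : ℝ≥0) (hB : 0 < B₀) : ∃ C : ℝ≥0,
    ∀ (I : Set ℝ) (k : Fin n → ℝ → ℝ → ℂ) (A : Finset (Fin n × Fin n)) (f : Fin n → ℝ → ℂ),
    (∀ i, Measurable (Function.uncurry (k i))) → (∀ i lam x, ‖k i lam x‖ ≤ B₀) →
    (∀ i, L2Bound I (k i) B₂) → (∀ i, Measurable (f i)) →
    (∀ i, IntegrableOn (fun x => ‖f i x‖ ^ p) (Ioi 0)) →
    (∀ i, ∫ x in Ioi 0, ‖f i x‖ ^ p ≤ 1) →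
    ∫⁻ lam in I, maximalOp k A f lam ^ (q / n) ≤ C := by
  have hq0 : 0 < q := by linarith
  have hn0 : (0 : ℝ) < n := by exact_mod_cast hn
  have hs : 0 < q / n := div_pos hq0 hn0
  -- any exponent strictly between `q / 2 - 1` and `q - 2` will do
  set δ : ℝ := 3 / 4 * (q - 2) with hδ
  obtain ⟨C₁, hC₁⟩ := exists_lintegral_dyadicSum_le n hpq hq (δ := δ) (by linarith) B₀ B₂ hB
  obtain ⟨C₂, hC₂⟩ := exists_multilinearOp_le_dyadicSum n hn hpq hq (δ := δ) (by linarith)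
  refine ⟨C₂ ^ (q / n) * C₁, ?_⟩
  intro I k A f hk hkB hL2 hf hfi hf1
  obtain ⟨S, hS, hSd⟩ := TopologicalSpace.exists_countable_dense ℝ≥0∞
  have hsup : ∀ lam, maximalOp k A f lam ^ (q / n) =
      ⨆ N, boundedMaximalOp S N k A f lam ^ (q / n) := by
    intro lam
    rw [maximalOp_eq_iSup_boundedMaximalOp hSd hk hf lam]
    exact (ENNReal.orderIsoRpow _ hs).map_iSup _
  simp only [hsup]
  rw [lintegral_iSup (fun N => (measurable_boundedMaximalOp hS N hk hf).pow_const _)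
    fun N M hNM lam => ENNReal.rpow_le_rpow (monotone_boundedMaximalOp S hNM lam) hs.le]
  refine iSup_le fun N => ?_
  set R : ℝ := (N : ℝ) + 1 with hR
  have hR0 : 0 < R := by positivity
  have hsub : Ioc 0 R ⊆ Ioi 0 := Ioc_subset_Ioi_self
  obtain ⟨U, hU, hUR, hU0, hU1, hUf⟩ := exists_quantile hR0 (fun i x => ‖f i x‖ ^ p)
    (fun i x => by positivity) (fun i => (hfi i).mono_set hsub) fun i =>
      (setIntegral_mono_set (hfi i) (ae_of_all _ fun x => by positivity)
        hsub.eventuallyLE).trans (hf1 i)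
  rw [Fintype.card_fin] at hUf
  have hW := hC₁ I k f R U hk hkB hL2 hf hfi hUR hU1 hUf
  have hWfin : ∀ᵐ lam ∂(volume.restrict I), dyadicSum q δ U k f lam < ∞ :=
    ae_lt_top (measurable_dyadicSum q δ U hk hf) (hW.trans_lt ENNReal.coe_lt_top).ne
  calc ∫⁻ lam in I, boundedMaximalOp S N k A f lam ^ (q / n)
      ≤ ∫⁻ lam in I, (C₂ : ℝ≥0∞) ^ (q / n) * dyadicSum q δ U k f lam := by
        refine lintegral_mono_ae ?_
        filter_upwards [hWfin] with lam hlam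
        have h1 : boundedMaximalOp S N k A f lam ≤ C₂ * dyadicSum q δ U k f lam ^ (n / q) := by
          refine iSup₂_le fun D hD => ?_
          refine hC₂ B₀ k A f R U hR0 hk hkB hf hfi hU hUR hU0 hU1 hUf lam hlam.ne _ fun i => ?_
          refine (hD i).2.trans ?_
          rw [← ENNReal.ofReal_natCast]
          exact ENNReal.ofReal_le_ofReal (by linarith)
        refine (ENNReal.rpow_le_rpow h1 hs.le).trans (le_of_eq ?_)
        rw [ENNReal.mul_rpow_of_nonneg _ _ hs.le, ← ENNReal.rpow_mul]
        have : (n : ℝ) / q * (q / n) = 1 := by field_simp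
        rw [this, ENNReal.rpow_one]
    _ = (C₂ : ℝ≥0∞) ^ (q / n) * ∫⁻ lam in I, dyadicSum q δ U k f lam :=
        lintegral_const_mul _ (measurable_dyadicSum q δ U hk hf)
    _ ≤ (C₂ : ℝ≥0∞) ^ (q / n) * C₁ := by gcongr
    _ = _ := by
        rw [ENNReal.coe_mul, ENNReal.coe_rpow_of_nonneg _ hs.le]

/-! ### Regularization of the kernels and the maximal theorem -/

/-- Kernels with the stated properties almost everywhere can be modified on a null set to be
measurable and bounded everywhere. -/
theorem exists_measurable_kernel {n : ℕ} {I : Set ℝ} (hI : NullMeasurableSet I volume) {B₀ B₂ : ℝ≥0}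
    {k : Fin n → ℝ → ℝ → ℂ}
    (hk : ∀ i, AEStronglyMeasurable (Function.uncurry (k i))
        ((volume.restrict I).prod (volume.restrict (Ioi (0 : ℝ)))))
    (hkB : ∀ i, ∀ lam ∈ I, ∀ x : ℝ, 0 < x → ‖k i lam x‖ ≤ B₀) (hL2 : ∀ i, L2Bound I (k i) B₂) :
    ∃ k' : Fin n → ℝ → ℝ → ℂ, (∀ i, Measurable (Function.uncurry (k' i))) ∧
      (∀ i lam x, ‖k' i lam x‖ ≤ B₀) ∧ (∀ i, L2Bound I (k' i) B₂) ∧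
      ∀ᵐ lam ∂(volume.restrict I), ∀ i, k i lam =ᵐ[volume.restrict (Ioi 0)] k' i lam := by
  set k' : Fin n → ℝ → ℝ → ℂ := fun i lam x =>
    {z : ℝ × ℝ | ‖(hk i).mk _ z‖ ≤ B₀}.indicator ((hk i).mk _) (lam, x) with hk'
  have hm : ∀ i, Measurable ((hk i).mk _) := fun i => (hk i).stronglyMeasurable_mk.measurable
  have hae : ∀ᵐ lam ∂(volume.restrict I), ∀ i, k i lam =ᵐ[volume.restrict (Ioi 0)] k' i lam := by
    refine ae_all_iff.2 fun i => ?_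
    filter_upwards [Measure.ae_ae_of_ae_prod (hk i).ae_eq_mk, ae_restrict_mem₀ hI] with lam h1 hlam
    filter_upwards [h1, ae_restrict_mem measurableSet_Ioi] with x hx hx0
    have hx' : k i lam x = (hk i).mk _ (lam, x) := hx
    have hB := hkB i lam hlam x hx0
    rw [hx'] at hB ⊢
    exact (indicator_of_mem (s := {z : ℝ × ℝ | ‖(hk i).mk _ z‖ ≤ B₀}) hB _).symm
  refine ⟨k', fun i => ?_, fun i lam x => ?_, fun i g hg hgb hgc => ?_, hae⟩
  · exact (hm i).indicator (measurableSet_le (hm i).norm measurable_const)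
  · by_cases h : (lam, x) ∈ {z : ℝ × ℝ | ‖(hk i).mk _ z‖ ≤ B₀}
    · simp only [hk', indicator_of_mem h]
      exact h
    · simp only [hk', indicator_of_notMem h, norm_zero]
      exact B₀.2
  · refine le_trans (le_of_eq (eLpNorm_congr_ae ?_)) (hL2 i g hg hgb hgc)
    filter_upwards [hae] with lam hlam
    refine integral_congr_ae ?_
    filter_upwards [hlam i] with x hx
    rw [hx]

theorem theorem5p2 (n : ℕ) (hn : 1 ≤ n) (p q s : ℝ≥0∞) (hp1 : 1 ≤ p) (hp2 : p < 2)
    (hpq : q⁻¹ + p⁻¹ = 1) (hs : s⁻¹ = (n : ℝ≥0∞) * q⁻¹) (B₀ B₂ : ℝ≥0) :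
    ∃ C : ℝ≥0, ∀ (I : Set ℝ) (k : Fin n → ℝ → ℝ → ℂ) (A : Finset (Fin n × Fin n)),
      NullMeasurableSet I volume →
      (∀ i, AEStronglyMeasurable (Function.uncurry (k i))
        ((volume.restrict I).prod (volume.restrict (Ioi (0 : ℝ))))) →
      (∀ i, ∀ lam ∈ I, ∀ x : ℝ, 0 < x → ‖k i lam x‖ ≤ B₀) →
      (∀ i, L2Bound I (k i) B₂) →
      ∀ f : Fin n → ℝ → ℂ, (∀ i, MemLp (f i) p (volume.restrict (Ioi (0 : ℝ)))) →
        (∀ᵐ lam ∂(volume.restrict I), ∀ D : Fin n → ℝ≥0∞, (∀ i, D i ≠ ∞) →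
          IntegrableOn (multilinearIntegrand (truncKernel k D) A f lam) (posOrthant n)) ∧
        AEMeasurable (maximalOp k A f) (volume.restrict I) ∧
        eLpNorm (maximalOp k A f) s (volume.restrict I)
          ≤ (C : ℝ≥0∞) * ∏ i, eLpNorm (f i) p (volume.restrict (Ioi (0 : ℝ))) := by
  have hp0 : p ≠ 0 := (zero_lt_one.trans_le hp1).ne'
  have hpt : p ≠ ∞ := (hp2.trans_le le_top).ne
  -- It suffices to prove the norm inequality for regularized kernels and functions.
  suffices hmain : ∃ C : ℝ≥0, ∀ (I : Set ℝ) (k : Fin n → ℝ → ℝ → ℂ) (A : Finset (Fin n × Fin n)),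
      (∀ i, Measurable (Function.uncurry (k i))) → (∀ i lam x, ‖k i lam x‖ ≤ B₀) →
      (∀ i, L2Bound I (k i) B₂) →
      ∀ f : Fin n → ℝ → ℂ, (∀ i, Measurable (f i)) →
        (∀ i, MemLp (f i) p (volume.restrict (Ioi (0 : ℝ)))) →
        eLpNorm (maximalOp k A f) s (volume.restrict I)
          ≤ (C : ℝ≥0∞) * ∏ i, eLpNorm (f i) p (volume.restrict (Ioi (0 : ℝ))) by
    obtain ⟨C, hC⟩ := hmain
    refine ⟨C, fun I k A hI hk hkB hL2 f hf => ?_⟩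
    obtain ⟨k', hk'm, hk'B, hk'L, hkk'⟩ := exists_measurable_kernel hI hk hkB hL2
    set f' : Fin n → ℝ → ℂ := fun i => (hf i).1.mk _ with hf'
    have hf'm : ∀ i, Measurable (f' i) := fun i => (hf i).1.stronglyMeasurable_mk.measurable
    have hff' : ∀ i, f i =ᵐ[volume.restrict (Ioi 0)] f' i := fun i => (hf i).1.ae_eq_mk
    have hf'p : ∀ i, MemLp (f' i) p (volume.restrict (Ioi 0)) := fun i =>
      (memLp_congr_ae (hff' i)).1 (hf i)
    have hmax : maximalOp k A f =ᵐ[volume.restrict I] maximalOp k' A f' := by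
      filter_upwards [hkk'] with lam hlam
      exact maximalOp_congr_ae hlam hff'
    refine ⟨?_, ⟨_, measurable_maximalOp hk'm hf'm, hmax⟩, ?_⟩
    · filter_upwards [hkk'] with lam hlam D hD
      refine Integrable.congr ?_ (multilinearIntegrand_congr_ae hlam hff' D).symm
      refine integrableOn_multilinearIntegrand hk'm hk'B hf'm (fun i => ?_) lam
      have hDm : MeasurableSet {y : ℝ | ENNReal.ofReal y < D i} :=
        measurableSet_lt ENNReal.measurable_ofReal measurable_const
      rw [IntegrableOn, integrable_indicator_iff hDm, IntegrableOn,
        Measure.restrict_restrict hDm]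
      have hsub : {y : ℝ | ENNReal.ofReal y < D i} ∩ Ioi 0 ⊆ Ioc 0 (D i).toReal := by
        rintro y ⟨hy, hy0⟩
        exact ⟨hy0, (ENNReal.ofReal_le_iff_le_toReal (hD i)).1 (le_of_lt hy)⟩
      have hint := integrableOn_of_integrable_rpow (p := p.toReal) (R := (D i).toReal)
        (by rw [← ENNReal.toReal_one]; exact ENNReal.toReal_mono hpt hp1) (hf'm i)
        ((hf'p i).integrable_norm_rpow hp0 hpt)
      exact hint.mono_set hsub
    · rw [eLpNorm_congr_ae hmax, Finset.prod_congr rfl fun i _ => eLpNorm_congr_ae (hff' i)]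
      exact hC I k' A hk'm hk'B hk'L f' hf'm hf'p
  rcases hp1.eq_or_lt with rfl | hp1'
  · have hq : q⁻¹ = 0 := by
      rw [inv_one] at hpq
      exact (ENNReal.add_left_inj ENNReal.one_ne_top).1 (hpq.trans (zero_add 1).symm)
    have hst : s = ∞ := by
      rw [hq, mul_zero, ENNReal.inv_eq_zero] at hs
      exact hs
    subst hst
    refine ⟨B₀ ^ n, fun I k A hk hkB hL2 f hf hfp => ?_⟩
    rw [eLpNorm_exponent_top]
    refine eLpNormEssSup_le_of_ae_enorm_bound (ae_of_all _ fun lam => ?_)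
    rw [enorm_eq_self]
    refine iSup₂_le fun D _ => ?_
    have hfi : ∀ i, IntegrableOn (f i) (Ioi 0) := fun i => memLp_one_iff_integrable.1 (hfp i)
    have h1 : ∀ i, eLpNorm (f i) 1 (volume.restrict (Ioi 0)) =
        ENNReal.ofReal (∫ x in Ioi 0, ‖f i x‖) := fun i => by
      rw [eLpNorm_one_eq_lintegral_enorm, ofReal_integral_norm_eq_lintegral_enorm (hfi i)]
    simp only [h1]
    rw [← ENNReal.ofReal_prod_of_nonneg fun i _ => integral_nonneg fun x => norm_nonneg _,
      ENNReal.coe_pow, ← ENNReal.ofReal_coe_nnreal, ← ENNReal.ofReal_pow B₀.coe_nonneg,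
      ← ENNReal.ofReal_mul (pow_nonneg B₀.coe_nonneg _), ← ofReal_norm]
    refine ENNReal.ofReal_le_ofReal ((norm_multilinearOp_le hkB hfi D lam).trans (le_of_eq ?_))
    rw [Finset.prod_mul_distrib, Finset.prod_const, Finset.card_univ, Fintype.card_fin]
  · have hpr : 1 < p.toReal := by
      rw [← ENNReal.toReal_one]
      exact ENNReal.toReal_strict_mono hpt hp1'
    have hpr2 : p.toReal < 2 := by
      have := ENNReal.toReal_strict_mono (ENNReal.ofNat_ne_top (n := 2)) hp2
      simpa using this
    have hconj : p.HolderConjugate q := ENNReal.holderConjugate_iff.2 (by rw [add_comm]; exact hpq)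
    have hpqr : p.toReal.HolderConjugate q.toReal := ENNReal.HolderConjugate.toReal hpr
    have hqr : 2 < q.toReal := by
      have := hpqr.mul_eq_add
      have := hpqr.symm.lt
      nlinarith
    have hq0 : 0 < q.toReal := by linarith
    have hn0 : (0 : ℝ) < n := by exact_mod_cast hn
    have hsr : s.toReal = q.toReal / n := by
      have := congrArg ENNReal.toReal hs
      rw [ENNReal.toReal_inv, ENNReal.toReal_mul, ENNReal.toReal_inv, ENNReal.toReal_natCast] at this
      rw [← inv_inv s.toReal, this]
      field_simp
    have hsr0 : 0 < s.toReal := by rw [hsr]; positivity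
    obtain ⟨hs0, hst⟩ := ENNReal.toReal_pos_iff.1 hsr0
    -- a positive bound for the kernels avoids a separate treatment of `B₀ = 0`
    obtain ⟨C, hC⟩ := exists_lintegral_maximalOp_rpow_le n hn hpqr hqr (B₀ + 1) B₂ (by positivity)
    refine ⟨C ^ (1 / s.toReal), fun I k A hk hkB hL2 f hf hfp => ?_⟩
    set N : Fin n → ℝ≥0∞ := fun i => eLpNorm (f i) p (volume.restrict (Ioi 0)) with hN
    have hNt : ∀ i, N i ≠ ∞ := fun i => (hfp i).2.ne
    set c : Fin n → ℂ := fun i => ((N i).toReal : ℂ) with hc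
    have hcN : ∀ i, ‖c i‖ₑ = N i := fun i => by
      rw [hc, ← ofReal_norm, Complex.norm_real, Real.norm_of_nonneg ENNReal.toReal_nonneg,
        ENNReal.ofReal_toReal (hNt i)]
    -- if `N i = 0`, then `(c i)⁻¹ = 0` and `f i` vanishes almost everywhere
    set g : Fin n → ℝ → ℂ := fun i => (c i)⁻¹ • f i with hg
    have hgm : ∀ i, Measurable (g i) := fun i => (hf i).const_smul _
    have hgp : ∀ i, MemLp (g i) p (volume.restrict (Ioi 0)) := fun i => (hfp i).const_smul _
    have hfg : ∀ i, f i =ᵐ[volume.restrict (Ioi 0)] fun x => c i * g i x := by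
      intro i
      by_cases h : c i = 0
      · have h0 : N i = 0 := by rw [← hcN, h, enorm_zero]
        filter_upwards [(eLpNorm_eq_zero_iff (hfp i).1 hp0).1 h0] with x hx
        rw [hx, h, zero_mul]; rfl
      · refine ae_of_all _ fun x => ?_
        simp only [hg, Pi.smul_apply, smul_eq_mul]
        rw [mul_inv_cancel_left₀ h]
    have hg1 : ∀ i, ∫ x in Ioi 0, ‖g i x‖ ^ p.toReal ≤ 1 := by
      intro i
      have h1 : eLpNorm (g i) p (volume.restrict (Ioi 0)) ≤ 1 := by
        rw [hg, eLpNorm_const_smul]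
        by_cases h : c i = 0
        · simp [h]
        · change ‖(c i)⁻¹‖ₑ * N i ≤ 1
          rw [enorm_inv h, hcN]
          exact ENNReal.inv_mul_le_one _
      rw [(hgp i).eLpNorm_eq_integral_rpow_norm hp0 hpt, ENNReal.ofReal_le_one] at h1
      have h2 : 0 ≤ ∫ x in Ioi 0, ‖g i x‖ ^ p.toReal := integral_nonneg fun x => by positivity
      by_contra hlt
      push Not at hlt
      exact absurd h1 (not_le.2 (Real.one_lt_rpow hlt (by positivity)))
    have hkey := hC I k A g hk (fun i lam x => (hkB i lam x).trans (by push_cast; linarith)) hL2 hgm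
      (fun i => (hgp i).integrable_norm_rpow hp0 hpt) hg1
    rw [← hsr] at hkey
    have hmax : ∀ lam, maximalOp k A f lam = (∏ i, N i) * maximalOp k A g lam := by
      intro lam
      rw [maximalOp_congr_ae (fun _ => Filter.EventuallyEq.rfl) hfg, maximalOp_const_mul]
      simp only [hcN]
    rw [eLpNorm_eq_lintegral_rpow_enorm_toReal hs0.ne' hst.ne]
    simp only [enorm_eq_self, hmax, ENNReal.mul_rpow_of_nonneg _ _ hsr0.le]
    rw [lintegral_const_mul _ ((measurable_maximalOp hk hgm).pow_const _),
      ENNReal.mul_rpow_of_nonneg _ _ (by positivity), ← ENNReal.rpow_mul, mul_one_div_cancel hsr0.ne',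
      ENNReal.rpow_one, mul_comm, ENNReal.coe_rpow_of_nonneg _ (by positivity)]
    gcongr
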